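/- Let $\Omega\subset\mathbb R^3$ be a bounded open set, $T>0$, $Y=[-\tfrac12,\tfrac12)^3$, and let $\frac32<p<\infty$. Let $\chi_f$ be the $Y$-periodic extension to $\mathbb R^3$ of the indicator function of a measurable set $F\subset Y$ (the inclusion phase), $\chi_m=1-\chi_f$, and put $$\rho(y)=\chi_f(y)\rho_f+\chi_m(y)\rho_m,\qquad \alpha(y,\hat y)=C_f\chi_f(y)\chi_f(\hat y)+C_m\chi_m(y)\chi_m(\hat y)+C_i\big(\chi_f(y)\chi_m(\hat y)+\chi_m(y)\chi_f(\hat y)\big),$$ with constants $\rho_f,\rho_m>0$ and $C_f,C_m,C_i\in\mathbb R$. Let $\lambda,\gamma,\delta>0$, let $H_r(a)$ denote the open ball of radius $r$ centred at $a$, and let $\chi_\Omega$ be the indicator function of $\Omega$. Let $L^p_{\rm per}(Y;C(\overline\Omega)^3)$ be the Banach space of ($Y$-periodic in $y$) $L^p$-functions on $Y$ with values in $C(\overline\Omega)^3$. Let $u_0,v_0\in L^p_{\rm per}(Y;C(\overline\Omega)^3)$, $b\in C([0,T];L^p_{\rm per}(Y;C(\overline\Omega)^3))$, and let $u\in C^2([0,T];L^p_{\rm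 per}(Y;C(\overline\Omega)^3))$ be the solution of the two-scale problem $$\begin{aligned}\rho(y)\partial_t^2u(x,y,t)={}&\int_{H_\gamma(x)\cap\Omega}\lambda\frac{(\hat x-x)\otimes(\hat x-x)}{|\hat x-x|^3}\Big(\int_Yu(\hat x,y',t)\,dy'-u(x,y,t)\Big)d\hat x\\&+\int_{H_\delta(y)}\alpha(y,\hat y)\frac{(\hat y-y)\otimes(\hat y-y)}{|\hat y-y|^3}\big(u(x,\hat y,t)-u(x,y,t)\big)d\hat y+b(x,y,t),\end{aligned}$$ with $u(x,y,0)=u_0(x,y)$ and $\partial_tu(x,y,0)=v_0(x,y)$. For $\varepsilon=\frac1n$, $n=1,2,\dots$, define the forcing term $d^\varepsilon(x,t)=\rho^{-1}\big(\tfrac x\varepsilon\big)\big(d^\varepsilon_{S,1}+d^\varepsilon_{S,2}+d^\varepsilon_L\big)(x,t)$, $x\in\Omega$, where $$\begin{aligned}d^\varepsilon_{S,1}&=\int_{H_\delta(0)}\chi_\Omega(x+\varepsilon z)\,\alpha\big(\tfrac x\varepsilon,\tfrac x\varepsilon+z\big)\frac{z\otimes z}{|z|^3}\big(u(x+\varepsilon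 z,\tfrac x\varepsilon+z,t)-u(x,\tfrac x\varepsilon+z,t)\big)dz,\\ d^\varepsilon_{S,2}&=-\int_{H_\delta(0)}\big(1-\chi_\Omega(x+\varepsilon z)\big)\alpha\big(\tfrac x\varepsilon,\tfrac x\varepsilon+z\big)\frac{z\otimes z}{|z|^3}\big(u(x,\tfrac x\varepsilon+z,t)-u(x,\tfrac x\varepsilon,t)\big)dz,\\ d^\varepsilon_L&=\int_{H_\gamma(0)}\chi_\Omega(x+\xi)\,\lambda\frac{\xi\otimes\xi}{|\xi|^3}\Big(u(x+\xi,\tfrac{x+\xi}\varepsilon,t)-\int_Yu(x+\xi,y',t)\,dy'\Big)d\xi.\end{aligned}$$ Then for every $\varepsilon=\frac1n$ and every $t\in[0,T]$ these integrals converge absolutely for almost every $x\in\Omega$, $d^\varepsilon$ belongs to $C([0,T];L^p(\Omega)^3)$ for every such $\varepsilon$, and $$\sup_{\varepsilon}\ \sup_{t\in[0,T]}\|d^\varepsilon(\cdot,t)\|_{L^p(\Omega)^3}<\infty,\qquad \lim_{\varepsilon\to0}\|d^\varepsilon(\cdot,t)\|_{L^p(\Omega)^3}=0\quad\text{for all }t\in[0,T].$$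 -/

import Mathlib

open MeasureTheory Set Filter
open scoped Topology ENNReal

noncomputable section

namespace Peridynamics

/-- Three-dimensional Euclidean space. -/
abbrev R3 := EuclideanSpace ℝ (Fin 3)

/-- The unit period cube `Y`, centred at the origin. -/
def Y : Set R3 := {y | ∀ i, y i ∈ Ico (-(1 / 2) : ℝ) (1 / 2)}

/-- The representative in `Y` of a point `y` modulo the lattice `ℤ³`. A function on `Y` is extended
`Y`-periodically to the whole space by composing it with `toCell`. -/
def toCell (y : R3) : R3 := WithLp.toLp 2 fun i => y i - (⌊y i + 1 / 2⌋ : ℝ)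

/-- A bounded open set `Ω ⊆ ℝ³` (the body). -/
structure Body where
  carrier : Set R3
  isOpen : IsOpen carrier
  isBounded : Bornology.IsBounded carrier

instance (Ω : Body) : CompactSpace (closure Ω.carrier) :=
  isCompact_iff_compactSpace.mp Ω.isBounded.isCompact_closure

/-- The indicator function `χ_Ω`. -/
def Body.chi (Ω : Body) (x : R3) : ℝ := Ω.carrier.indicator (fun _ => (1 : ℝ)) x

/-- The constitutive data of the two-phase periodic medium: the inclusion phase inside the period
cube, bond strengths, densities, the long-range stiffness, and the two horizons. No relation
between the three bond strengths is needed. -/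
structure Medium where
  /-- the part of the period cube occupied by the inclusion phase -/
  inclusion : Set R3
  inclusion_subset : inclusion ⊆ Y
  measurableSet_inclusion : MeasurableSet inclusion
  /-- bond strength inside the inclusion phase -/
  Cf : ℝ
  /-- bond strength inside the matrix phase -/
  Cm : ℝ
  /-- bond strength across an interface -/
  Ci : ℝ
  /-- density of the inclusion phase -/
  rhof : ℝ
  /-- density of the matrix phase -/
  rhom : ℝ
  /-- stiffness of the long-range force -/
  lam : ℝ
  /-- horizon of the long-range force -/
  gam : ℝ
  /-- horizon of the short-range force, in the fast variable -/
  del : ℝ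
  rhof_pos : 0 < rhof
  rhom_pos : 0 < rhom
  lam_pos : 0 < lam
  gam_pos : 0 < gam
  del_pos : 0 < del

namespace Medium

variable (M : Medium)

/-- The periodically extended indicator function of the inclusion phase. -/
def chif (y : R3) : ℝ := M.inclusion.indicator (fun _ => (1 : ℝ)) (toCell y)

/-- The periodically extended indicator function of the matrix phase. -/
def chim (y : R3) : ℝ := 1 - M.chif y

/-- The periodic density `ρ(y)`. -/
def rho (y : R3) : ℝ := M.chif y * M.rhof + M.chim y * M.rhom

/-- The bond strength `α(y, ŷ)` (without the cut-off at the horizon). -/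
def alpha (y y' : R3) : ℝ :=
  M.Cf * (M.chif y * M.chif y') + M.Cm * (M.chim y * M.chim y')
    + M.Ci * (M.chif y * M.chim y' + M.chim y * M.chif y')

end Medium

/-- The kernel `(ξ ⊗ ξ) / |ξ|³` applied to the vector `v`. -/
def bond (ξ v : R3) : R3 := (inner ℝ ξ v / ‖ξ‖ ^ 3) • ξ

/-- The Banach space `L^p_per(Y; C(Ω̄)³)`; its elements are given by their restrictions to the
period cube, and `eval` below is the periodic extension. -/
abbrev LpPer (Ω : Body) (p : ℝ≥0∞) :=
  Lp C(closure Ω.carrier, R3) p ((volume : Measure R3).restrict Y)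

open Classical in
/-- The value `w(x, y)` of an element of `L^p_per(Y; C(Ω̄)³)`, extended `Y`-periodically in `y` and
by zero to `x` outside `Ω̄`. -/
def LpPer.eval {Ω : Body} {p : ℝ≥0∞} (w : LpPer Ω p) (x y : R3) : R3 :=
  if h : x ∈ closure Ω.carrier then w (toCell y) ⟨x, h⟩ else 0

section TwoScale

variable (M : Medium) (Ω : Body)

/-- The long-range two-scale operator `B_L`. -/
def BL (w : R3 → R3 → R3) (x y : R3) : R3 :=
  ∫ x' in Metric.ball x M.gam ∩ Ω.carrier,
    M.lam • bond (x' - x) ((∫ y' in Y, w x' y') - w x y)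

/-- The short-range two-scale operator `B_S`. -/
def BS (w : R3 → R3 → R3) (x y : R3) : R3 :=
  ∫ y' in Metric.ball y M.del, M.alpha y y' • bond (y' - y) (w x y' - w x y)

/-- `u` belongs to `C²([0,T]; L^p_per(Y; C(Ω̄)³))` and solves the two-scale peridynamic
initial-value problem `ρ ∂ₜ²u = B_L u + B_S u + b`, `u(0) = u₀`, `∂ₜu(0) = v₀`. -/
structure IsTwoScaleSolution {p : ℝ≥0∞} [Fact (1 ≤ p)] (T : ℝ) (u₀ v₀ : LpPer Ω p)
    (b u : ℝ → LpPer Ω p) : Prop where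
  contDiffOn : ContDiffOn ℝ 2 u (Icc 0 T)
  equation : ∀ t ∈ Icc 0 T, ∀ᵐ y ∂((volume : Measure R3).restrict Y), ∀ x ∈ Ω.carrier,
    M.rho y • LpPer.eval (iteratedDerivWithin 2 u (Icc 0 T) t) x y
      = BL M Ω (LpPer.eval (u t)) x y + BS M (LpPer.eval (u t)) x y + LpPer.eval (b t) x y
  initial_displacement : u 0 = u₀
  initial_velocity : derivWithin u (Icc 0 T) 0 = v₀

end TwoScale

section Forcing

/-! The forcing term, for a two-scale field `w = w(x, y)` (which will be `u(·, ·, t)`). -/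

variable (M : Medium) (Ω : Body) (w : R3 → R3 → R3) (ε : ℝ) (x : R3)

/-- The integrand of `d_{S,1}^ε(x)`. -/
def integrandS1 (z : R3) : R3 :=
  (Ω.chi (x + ε • z) * M.alpha (ε⁻¹ • x) (ε⁻¹ • x + z)) •
    bond z (w (x + ε • z) (ε⁻¹ • x + z) - w x (ε⁻¹ • x + z))

/-- The integrand of `d_{S,2}^ε(x)` (without the minus sign). -/
def integrandS2 (z : R3) : R3 :=
  ((1 - Ω.chi (x + ε • z)) * M.alpha (ε⁻¹ • x) (ε⁻¹ • x + z)) •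
    bond z (w x (ε⁻¹ • x + z) - w x (ε⁻¹ • x))

/-- The integrand of `d_L^ε(x)`. -/
def integrandL (ξ : R3) : R3 :=
  (Ω.chi (x + ξ) * M.lam) •
    bond ξ (w (x + ξ) (ε⁻¹ • (x + ξ)) - ∫ y' in Y, w (x + ξ) y')

/-- `d_{S,1}^ε(x)` -/
def dS1 : R3 := ∫ z in Metric.ball (0 : R3) M.del, integrandS1 M Ω w ε x z

/-- `d_{S,2}^ε(x)` -/
def dS2 : R3 := -∫ z in Metric.ball (0 : R3) M.del, integrandS2 M Ω w ε x z

/-- `d_L^ε(x)` -/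
def dL : R3 := ∫ ξ in Metric.ball (0 : R3) M.gam, integrandL M Ω w ε x ξ

/-- The forcing term `d^ε(x) = ρ(x/ε)⁻¹ (d_{S,1}^ε + d_{S,2}^ε + d_L^ε)(x)`. -/
def forcing : R3 :=
  (M.rho (ε⁻¹ • x))⁻¹ • (dS1 M Ω w ε x + dS2 M Ω w ε x + dL M Ω w ε x)

/-- The integrals that define `d^ε(x)` converge absolutely. -/
def ForcingConverges : Prop :=
  IntegrableOn (integrandS1 M Ω w ε x) (Metric.ball 0 M.del) ∧
  IntegrableOn (integrandS2 M Ω w ε x) (Metric.ball 0 M.del) ∧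
  IntegrableOn (integrandL M Ω w ε x) (Metric.ball 0 M.gam)

end Forcing

end Peridynamics

end

open Peridynamics

/-!
For a fixed scale `ε ≤ 1` the forcing term depends linearly on the two-scale field, and
`w ↦ d^ε` maps `L^p_per(Y; C(Ω̄)³)` to `L^p(Ω)³` with a norm bounded independently of `ε`: the
kernel is dominated by `1 / |z|`, which is integrable near the origin of `ℝ³`, so that
Minkowski's integral inequality reduces the bound to the oscillating functions
`x ↦ w(·, x / ε + z)`, whose `L^p` norms on `Ω` are controlled by the norm of `w` over the period
cell. By density it is then enough to let `ε` tend to zero for the fields `1_A(y) g(x)`. There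
`d_{S,1}` vanishes in the limit because `g` is continuous, `d_{S,2}` because `x` is an interior
point of `Ω`, and `d_L` because a rapidly oscillating function of mean zero converges weakly to
zero.
-/

namespace Peridynamics

section PeriodCell

lemma toCell_apply (y : R3) (i : Fin 3) : toCell y i = y i - (⌊y i + 1 / 2⌋ : ℝ) := rfl

lemma toCell_of_mem_Y {y : R3} (hy : y ∈ Y) : toCell y = y := by
  ext i
  have h : ⌊y i + 1 / 2⌋ = 0 := by
    rw [Int.floor_eq_iff]
    constructor <;> push_cast <;> linarith [(hy i).1, (hy i).2]
  rw [toCell_apply, h, Int.cast_zero, sub_zero]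

lemma toCell_add_of_int {k : R3} (hk : ∀ i, ∃ m : ℤ, (m : ℝ) = k i) (y : R3) :
    toCell (k + y) = toCell y := by
  ext i
  obtain ⟨m, hm⟩ := hk i
  simp only [toCell_apply, PiLp.add_apply, ← hm, add_assoc, Int.floor_intCast_add]
  push_cast
  ring

lemma measurable_toCell : Measurable toCell := by
  unfold toCell
  fun_prop

lemma Y_eq_preimage_pi :
    Y = (WithLp.ofLp : R3 → Fin 3 → ℝ) ⁻¹' univ.pi fun _ => Ico (-(1 / 2) : ℝ) (1 / 2) := by
  ext y
  simp [Y]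

lemma measurableSet_Y : MeasurableSet Y := by
  rw [Y_eq_preimage_pi]
  exact (MeasurableSet.univ_pi fun _ => measurableSet_Ico).preimage (by fun_prop)

lemma volume_Y : volume Y = 1 := by
  rw [Y_eq_preimage_pi, (PiLp.volume_preserving_ofLp (Fin 3)).measure_preimage
    (MeasurableSet.univ_pi fun _ => measurableSet_Ico).nullMeasurableSet, Real.volume_pi_Ico]
  norm_num

instance : IsProbabilityMeasure (volume.restrict Y) :=
  ⟨by rw [Measure.restrict_apply_univ, volume_Y]⟩

lemma norm_le_one_of_mem_Y {s : R3} (hs : s ∈ Y) : ‖s‖ ≤ 1 := by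
  have h : ∀ i, ‖s i‖ ^ 2 ≤ 1 / 4 := fun i => by
    rw [Real.norm_eq_abs, sq_abs]
    nlinarith [(hs i).1, (hs i).2]
  rw [EuclideanSpace.norm_eq, Real.sqrt_le_iff, Fin.sum_univ_three]
  exact ⟨zero_le_one, by linarith [h 0, h 1, h 2]⟩

/-- The lattice `ℤ³` of periods. -/
abbrev cellLattice : Submodule ℤ R3 :=
  Submodule.span ℤ (range (EuclideanSpace.basisFun (Fin 3) ℝ).toBasis)

instance : VAddInvariantMeasure cellLattice R3 volume :=
  inferInstanceAs (VAddInvariantMeasure cellLattice.toAddSubgroup R3 volume)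

lemma toCell_vadd (k : cellLattice) (y : R3) : toCell (k +ᵥ y) = toCell y := by
  refine toCell_add_of_int (fun i => ?_) y
  simpa using (Module.Basis.mem_span_iff_repr_mem ℤ _ _).1 k.2 i

lemma isAddFundamentalDomain_shifted_Y (a : R3) :
    IsAddFundamentalDomain cellLattice {y | y - a ∈ Y} volume := by
  refine IsAddFundamentalDomain.mk'
    (measurableSet_Y.preimage (measurable_id.sub_const a)).nullMeasurableSet fun x => ?_
  -- `Y` is the fundamental cube `[0, 1)³` of `ZSpan`, moved to be centred at the origin
  convert ZSpan.exist_unique_vadd_mem_fundamentalDomain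
    (EuclideanSpace.basisFun (Fin 3) ℝ).toBasis (x - a + WithLp.toLp 2 fun _ => 1 / 2)
    using 2 with k
  simp only [mem_ofPred_eq, Y, ZSpan.mem_fundamentalDomain, Submodule.vadd_def, vadd_eq_add,
    mem_Ico, PiLp.add_apply, PiLp.sub_apply, OrthonormalBasis.coe_toBasis_repr_apply,
    EuclideanSpace.basisFun_repr]
  refine forall_congr' fun i => ?_
  constructor <;> rintro ⟨h1, h2⟩ <;> constructor <;> linarith

lemma setLIntegral_toCell_add (F : R3 → ℝ≥0∞) (a : R3) :
    ∫⁻ s in Y, F (toCell (a + s)) = ∫⁻ s in Y, F s := by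
  have hY := isAddFundamentalDomain_shifted_Y 0
  simp only [sub_zero, ofPred_mem_eq] at hY
  calc ∫⁻ s in Y, F (toCell (a + s)) = ∫⁻ y in {y | y - a ∈ Y}, F (toCell y) := by
        rw [← (measurePreserving_add_left volume a).setLIntegral_comp_preimage_emb
          (measurableEmbedding_addLeft a) (fun y => F (toCell y)) {y | y - a ∈ Y}]
        simp
    _ = ∫⁻ y in Y, F (toCell y) :=
        (isAddFundamentalDomain_shifted_Y a).setLIntegral_eq hY (fun y => F (toCell y))
          fun k y => by rw [toCell_vadd]
    _ = ∫⁻ s in Y, F s :=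
        setLIntegral_congr_fun measurableSet_Y fun s hs => by rw [toCell_of_mem_Y hs]

lemma measurePreserving_toCell_add (a : R3) :
    MeasurePreserving (fun s => toCell (a + s)) (volume.restrict Y) (volume.restrict Y) := by
  have hm : Measurable fun s => toCell (a + s) := measurable_toCell.comp (measurable_const_add a)
  refine ⟨hm, Measure.ext_of_lintegral _ fun F hF => ?_⟩
  rw [lintegral_map hF hm, setLIntegral_toCell_add]

end PeriodCell

section Oscillation

variable {E : Type*} [TopologicalSpace E] [ContinuousENorm E] {S : Set R3} {ε : ℝ}

lemma setLIntegral_oscillation_le_shift (hS : MeasurableSet S) (F : R3 → ℝ≥0∞) (hε : 0 < ε)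
    (hε1 : ε ≤ 1) (z : R3) {s : R3} (hs : s ∈ Y) :
    ∫⁻ x in S, F (toCell (ε⁻¹ • x + z))
      ≤ ∫⁻ x in Metric.cthickening 1 S, F (toCell (ε⁻¹ • x + z + s)) := by
  rw [← lintegral_indicator hS, ← lintegral_indicator Metric.isClosed_cthickening.measurableSet,
    ← lintegral_add_right_eq_self _ (ε • s)]
  refine lintegral_mono fun x => ?_
  by_cases hx : x + ε • s ∈ S
  · have hx' : x ∈ Metric.cthickening 1 S := by
      refine Metric.mem_cthickening_of_dist_le x (x + ε • s) 1 S hx ?_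
      rw [dist_self_add_right, norm_smul, Real.norm_of_nonneg hε.le]
      exact mul_le_one₀ hε1 (norm_nonneg s) (norm_le_one_of_mem_Y hs)
    rw [indicator_of_mem hx, indicator_of_mem hx', smul_add, inv_smul_smul₀ hε.ne',
      add_right_comm]
  · rw [indicator_of_notMem hx]
    exact zero_le

-- Averaging over shifts by `ε Y` turns the oscillating function into its mean over the cell.
lemma setLIntegral_oscillation_le (hS : MeasurableSet S) {F : R3 → ℝ≥0∞} (hF : Measurable F)
    (hε : 0 < ε) (hε1 : ε ≤ 1) (z : R3) :
    ∫⁻ x in S, F (toCell (ε⁻¹ • x + z))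
      ≤ volume (Metric.cthickening 1 S) * ∫⁻ y in Y, F y := by
  calc ∫⁻ x in S, F (toCell (ε⁻¹ • x + z))
      = ∫⁻ _ in Y, ∫⁻ x in S, F (toCell (ε⁻¹ • x + z)) := by
        rw [lintegral_const, measure_univ, mul_one]
    _ ≤ ∫⁻ s in Y, ∫⁻ x in Metric.cthickening 1 S, F (toCell (ε⁻¹ • x + z + s)) :=
        setLIntegral_mono' measurableSet_Y fun _ hs =>
          setLIntegral_oscillation_le_shift hS F hε hε1 z hs
    _ = ∫⁻ x in Metric.cthickening 1 S, ∫⁻ s in Y, F (toCell (ε⁻¹ • x + z + s)) :=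
        lintegral_lintegral_swap
          (hF.comp (measurable_toCell.comp (by fun_prop))).aemeasurable
    _ = volume (Metric.cthickening 1 S) * ∫⁻ y in Y, F y := by
        simp_rw [setLIntegral_toCell_add F]
        rw [lintegral_const, Measure.restrict_apply_univ, mul_comm]

lemma map_oscillation_le (hS : MeasurableSet S) (hε : 0 < ε) (hε1 : ε ≤ 1) (z : R3) :
    (volume.restrict S).map (fun x => toCell (ε⁻¹ • x + z))
      ≤ volume (Metric.cthickening 1 S) • volume.restrict Y := by
  have hm : Measurable fun x : R3 => toCell (ε⁻¹ • x + z) := measurable_toCell.comp (by fun_prop)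
  refine Measure.le_iff.2 fun B hB => ?_
  have hone : Measurable (B.indicator (1 : R3 → ℝ≥0∞)) := measurable_one.indicator hB
  rw [Measure.smul_apply, smul_eq_mul, ← lintegral_indicator_one hB, ← lintegral_indicator_one hB,
    lintegral_map hone hm]
  exact setLIntegral_oscillation_le hS hone hε hε1 z

/-- The constant `|{x : dist(x, Ω) ≤ 1}|^{1/p}` by which the `L^p(Ω)`-norm of an oscillating
function `f(x/ε)`, `ε ≤ 1`, exceeds at most the norm of `f` over the period cell. -/
noncomputable def Body.oscBound (Ω : Body) (p : ℝ≥0∞) : ℝ≥0∞ :=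
  volume (Metric.cthickening 1 Ω.carrier) ^ p.toReal⁻¹

lemma Body.oscBound_ne_top (Ω : Body) (p : ℝ≥0∞) : Ω.oscBound p ≠ ∞ :=
  ENNReal.rpow_ne_top_of_nonneg (by positivity) Ω.isBounded.cthickening.measure_lt_top.ne

lemma eLpNorm_oscillation_le (Ω : Body) {f : R3 → E} (hf : StronglyMeasurable f) {p : ℝ≥0∞}
    (hp : p ≠ ∞) (hε : 0 < ε) (hε1 : ε ≤ 1) (z : R3) :
    eLpNorm (fun x => f (toCell (ε⁻¹ • x + z))) p (volume.restrict Ω.carrier)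
      ≤ Ω.oscBound p * eLpNorm f p (volume.restrict Y) := by
  have hm : Measurable fun x : R3 => toCell (ε⁻¹ • x + z) := measurable_toCell.comp (by fun_prop)
  calc eLpNorm (fun x => f (toCell (ε⁻¹ • x + z))) p (volume.restrict Ω.carrier)
      = eLpNorm f p ((volume.restrict Ω.carrier).map fun x => toCell (ε⁻¹ • x + z)) :=
        (eLpNorm_map_measure hf.aestronglyMeasurable hm.aemeasurable).symm
    _ ≤ eLpNorm f p (volume (Metric.cthickening 1 Ω.carrier) • volume.restrict Y) :=
        eLpNorm_mono_measure f (map_oscillation_le Ω.isOpen.measurableSet hε hε1 z)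
    _ = Ω.oscBound p * eLpNorm f p (volume.restrict Y) := by
        rw [eLpNorm_smul_measure_of_ne_top hp, Body.oscBound, smul_eq_mul, one_div,
          ENNReal.toReal_inv]

end Oscillation

section WeakConvergence

lemma tendsto_integral_norm_translate_sub {G F : Type*} [NormedAddCommGroup G] [NormedSpace ℝ G]
    [FiniteDimensional ℝ G] [MeasurableSpace G] [BorelSpace G] {μ : Measure G} [μ.IsAddHaarMeasure]
    [NormedAddCommGroup F] {h : G → F} (hh : Integrable h μ) :
    Tendsto (fun v => ∫ ξ, ‖h (v + ξ) - h ξ‖ ∂μ) (𝓝 0) (𝓝 0) := by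
  have : Fact ((1 : ℝ≥0∞) ≠ ∞) := ⟨ENNReal.one_ne_top⟩
  have hm : MemLp h 1 μ := memLp_one_iff_integrable.2 hh
  have hc : Continuous fun v : G => DomAddAct.mk v +ᵥ hm.toLp h :=
    DomAddAct.continuous_mk.vadd continuous_const
  have h0 := (hc.tendsto 0).dist (tendsto_const_nhds (x := hm.toLp h))
  rw [DomAddAct.mk_zero, zero_vadd, dist_self] at h0
  refine h0.congr fun v => ?_
  rw [dist_eq_norm, DomAddAct.mk_vadd_toLp, ← MemLp.toLp_sub, Lp.norm_toLp,
    eLpNorm_one_eq_lintegral_enorm, integral_norm_eq_lintegral_enorm]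
  · rfl
  · exact ((hh.comp_add_left v).sub hh).1

variable {F : Type*} [NormedAddCommGroup F] [NormedSpace ℝ F] {h : R3 → F} {φ : R3 → ℝ} {B : ℝ}

lemma setIntegral_toCell_add (hφ : Measurable φ) (a : R3) :
    ∫ s in Y, φ (toCell (a + s)) = ∫ s in Y, φ s := by
  have hmp := measurePreserving_toCell_add a
  rw [← integral_map hmp.measurable.aemeasurable hφ.aestronglyMeasurable, hmp.map_eq]

lemma integrable_oscillation_smul {X : Type*} [MeasurableSpace X] {μ : Measure X} {g : X → F}
    (hg : Integrable g μ) (hφ : Measurable φ) (hB : ∀ y, |φ y| ≤ B) {a : X → R3}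
    (ha : Measurable a) : Integrable (fun q => φ (toCell (a q)) • g q) μ :=
  hg.bdd_smul B (hφ.comp (measurable_toCell.comp ha)).aestronglyMeasurable
    (Eventually.of_forall fun _ => hB _)

lemma integrable_uncurry_oscillation_smul (hh : Integrable h) (hφ : Measurable φ)
    (hB : ∀ y, |φ y| ≤ B) (ε : ℝ) :
    Integrable (Function.uncurry fun s ξ => φ (toCell (ε⁻¹ • ξ + s)) • h ξ)
      ((volume.restrict Y).prod volume) :=
  integrable_oscillation_smul (hh.comp_snd _) hφ hB (by fun_prop)

lemma setIntegral_integral_oscillation_eq_zero [CompleteSpace F] (hh : Integrable h)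
    (hφ : Measurable φ) (hB : ∀ y, |φ y| ≤ B) (h0 : ∫ y in Y, φ y = 0) (ε : ℝ) :
    ∫ s in Y, ∫ ξ, φ (toCell (ε⁻¹ • ξ + s)) • h ξ = 0 := by
  simp_rw [integral_integral_swap (integrable_uncurry_oscillation_smul hh hφ hB ε),
    integral_smul_const, setIntegral_toCell_add hφ, h0, zero_smul, integral_zero]

lemma norm_integral_oscillation_sub_shift_le (hh : Integrable h) (hφ : Measurable φ)
    (hB : ∀ y, |φ y| ≤ B) {ε : ℝ} (hε : ε ≠ 0) (s : R3) :
    ‖(∫ ξ, φ (toCell (ε⁻¹ • ξ)) • h ξ) - ∫ ξ, φ (toCell (ε⁻¹ • ξ + s)) • h ξ‖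
      ≤ B * ∫ ξ, ‖h (ε • s + ξ) - h ξ‖ := by
  have hshift : ∫ ξ, φ (toCell (ε⁻¹ • ξ)) • h ξ
      = ∫ ξ, φ (toCell (ε⁻¹ • ξ + s)) • h (ε • s + ξ) := by
    rw [← integral_add_left_eq_self _ (ε • s)]
    simp only [smul_add, inv_smul_smul₀ hε, add_comm s]
  have hh' := hh.comp_add_left (ε • s)
  rw [hshift, ← integral_sub (integrable_oscillation_smul hh' hφ hB (by fun_prop))
    (integrable_oscillation_smul hh hφ hB (by fun_prop)), ← integral_const_mul]
  refine norm_integral_le_of_norm_le ((hh'.sub hh).norm.const_mul B)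
    (Eventually.of_forall fun ξ => ?_)
  rw [← smul_sub, norm_smul]
  exact mul_le_mul_of_nonneg_right (hB _) (norm_nonneg _)

-- The mean of the shifted integrals over `s ∈ Y` vanishes, and every shift by `ε s` is small.
lemma norm_integral_oscillation_le [CompleteSpace F] (hh : Integrable h) (hφ : Measurable φ)
    (hB : ∀ y, |φ y| ≤ B) (h0 : ∫ y in Y, φ y = 0) {ε η : ℝ} (hε : ε ≠ 0)
    (hη : ∀ s ∈ Y, ∫ ξ, ‖h (ε • s + ξ) - h ξ‖ ≤ η) :
    ‖∫ ξ, φ (toCell (ε⁻¹ • ξ)) • h ξ‖ ≤ B * η := by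
  have hB0 : 0 ≤ B := (abs_nonneg _).trans (hB 0)
  set I := ∫ ξ, φ (toCell (ε⁻¹ • ξ)) • h ξ
  have hint : Integrable (fun s => ∫ ξ, φ (toCell (ε⁻¹ • ξ + s)) • h ξ) (volume.restrict Y) :=
    (integrable_uncurry_oscillation_smul hh hφ hB ε).integral_prod_left
  have hmean : I = ∫ s in Y, (I - ∫ ξ, φ (toCell (ε⁻¹ • ξ + s)) • h ξ) := by
    rw [integral_sub (integrable_const _) hint,
      setIntegral_integral_oscillation_eq_zero hh hφ hB h0, sub_zero]
    simp [Measure.real]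
  rw [hmean]
  refine (norm_setIntegral_le_of_norm_le_const (by simp [volume_Y]) fun s hs =>
    (norm_integral_oscillation_sub_shift_le hh hφ hB hε s).trans
      (mul_le_mul_of_nonneg_left (hη s hs) hB0)).trans_eq ?_
  rw [Measure.real, volume_Y, ENNReal.toReal_one, mul_one]

theorem tendsto_integral_oscillation [CompleteSpace F] (hh : Integrable h) (hφ : Measurable φ)
    (hB : ∀ y, |φ y| ≤ B) (h0 : ∫ y in Y, φ y = 0) :
    Tendsto (fun ε : ℝ => ∫ ξ, φ (toCell (ε⁻¹ • ξ)) • h ξ) (𝓝[>] 0) (𝓝 0) := by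
  have hB0 : 0 ≤ B := (abs_nonneg _).trans (hB 0)
  refine Metric.tendsto_nhds.2 fun e he => ?_
  have hη : 0 < e / (B + 1) := by positivity
  obtain ⟨r, hr, hsmall⟩ := Metric.eventually_nhds_iff.1
    ((tendsto_integral_norm_translate_sub hh).eventually (ge_mem_nhds hη))
  filter_upwards [Ioo_mem_nhdsGT hr] with ε hε
  rw [dist_zero_right]
  refine (norm_integral_oscillation_le hh hφ hB h0 hε.1.ne' fun s hs => hsmall ?_).trans_lt ?_
  · rw [dist_zero_right, norm_smul, Real.norm_of_nonneg hε.1.le]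
    exact (mul_le_of_le_one_right hε.1.le (norm_le_one_of_mem_Y hs)).trans_lt hε.2
  · rw [← mul_div_assoc, div_lt_iff₀ (by positivity)]
    nlinarith

end WeakConvergence

section Minkowski

variable {X Z : Type*} [MeasurableSpace X] [MeasurableSpace Z] {ν : Measure X} {μ : Measure Z}

lemma rpow_lintegral_le {P : ℝ} (hP : 1 ≤ P) {f : Z → ℝ≥0∞} (hf : Measurable f) :
    (∫⁻ z, f z ∂μ) ^ P ≤ (∫⁻ z, f z ^ P ∂μ) * μ univ ^ (P - 1) := by
  have hP0 : 0 < P := zero_lt_one.trans_le hP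
  have h := eLpNorm'_le_eLpNorm'_mul_rpow_measure_univ (μ := μ) zero_lt_one hP
    hf.aestronglyMeasurable
  simp only [eLpNorm'_eq_lintegral_enorm, enorm_eq_self, ENNReal.rpow_one, div_one] at h
  refine (ENNReal.rpow_le_rpow h hP0.le).trans_eq ?_
  rw [ENNReal.mul_rpow_of_nonneg _ _ hP0.le, ← ENNReal.rpow_mul, ← ENNReal.rpow_mul,
    one_div_mul_cancel hP0.ne', ENNReal.rpow_one, sub_mul, one_div_mul_cancel hP0.ne', one_mul]

lemma eLpNorm_lintegral_le [SFinite ν] [IsFiniteMeasure μ] {p : ℝ≥0∞} (hp1 : 1 ≤ p) (hp : p ≠ ∞)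
    {G : X → Z → ℝ≥0∞} (hG : Measurable (Function.uncurry G)) {A : ℝ≥0∞}
    (hA : ∀ z, eLpNorm (fun x => G x z) p ν ≤ A) :
    eLpNorm (fun x => ∫⁻ z, G x z ∂μ) p ν ≤ μ univ * A := by
  have hp0 : p ≠ 0 := (zero_lt_one.trans_le hp1).ne'
  have hP1 : 1 ≤ p.toReal := by simpa using ENNReal.toReal_mono hp hp1
  have hP0 : 0 < p.toReal := zero_lt_one.trans_le hP1
  simp_rw [eLpNorm_eq_lintegral_rpow_enorm_toReal hp0 hp, one_div, enorm_eq_self,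
    ENNReal.rpow_inv_le_iff hP0] at hA ⊢
  generalize p.toReal = P at *
  calc ∫⁻ x, (∫⁻ z, G x z ∂μ) ^ P ∂ν
      ≤ ∫⁻ x, (∫⁻ z, G x z ^ P ∂μ) * μ univ ^ (P - 1) ∂ν :=
        lintegral_mono fun _ => rpow_lintegral_le hP1 (hG.comp measurable_prodMk_left)
    _ = (∫⁻ z, ∫⁻ x, G x z ^ P ∂ν ∂μ) * μ univ ^ (P - 1) := by
        rw [lintegral_mul_const', lintegral_lintegral_swap (hG.pow_const P).aemeasurable]
        exact ENNReal.rpow_ne_top_of_nonneg (by linarith) (measure_ne_top μ _)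
    _ ≤ (∫⁻ _, A ^ P ∂μ) * μ univ ^ (P - 1) := by gcongr with z; exact hA z
    _ = (μ univ * A) ^ P := by
        have hsplit : μ univ ^ P = μ univ ^ (P - 1) * μ univ := by
          conv_lhs => rw [← sub_add_cancel P 1]
          rw [ENNReal.rpow_add_of_nonneg _ _ (by linarith) zero_le_one, ENNReal.rpow_one]
        rw [lintegral_const, ENNReal.mul_rpow_of_nonneg _ _ hP0.le, hsplit]
        ring

end Minkowski

section WeaklySingular

lemma integrableOn_inv_norm_ball {E : Type*} [NormedAddCommGroup E] [NormedSpace ℝ E]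
    [FiniteDimensional ℝ E] [MeasurableSpace E] [BorelSpace E] (μ : Measure E) [μ.IsAddHaarMeasure]
    (hE : 1 < Module.finrank ℝ E) (r : ℝ) :
    IntegrableOn (fun z : E => ‖z‖⁻¹) (Metric.ball 0 r) μ := by
  have : Nontrivial E := Module.nontrivial_of_finrank_pos (zero_lt_one.trans hE)
  rw [integrableOn_fun_norm_addHaar μ (f := fun t => t⁻¹)]
  have h : IntegrableOn (fun t : ℝ => t ^ (Module.finrank ℝ E - 2)) (Ioo 0 r) :=
    (continuous_pow _).integrableOn_Icc.mono_set Ioo_subset_Icc_self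
  refine h.congr_fun (fun t ht => ?_) measurableSet_Ioo
  obtain ⟨d, hd⟩ := Nat.exists_eq_add_of_lt hE
  have ht0 : t ≠ 0 := ht.1.ne'
  simp only [hd, smul_eq_mul, show 1 + d + 1 - 2 = d by omega, show 1 + d + 1 - 1 = d + 1 by omega]
  field_simp
  ring

/-- The measure `|z|⁻¹ dz` on the ball of radius `r`; its density dominates the kernel of
`bond`. -/
noncomputable def kernelMeasure (r : ℝ) : Measure R3 :=
  (volume.restrict (Metric.ball 0 r)).withDensity fun z => ENNReal.ofReal ‖z‖⁻¹

lemma integrableOn_inv_norm_ball_R3 (r : ℝ) :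
    IntegrableOn (fun z : R3 => ‖z‖⁻¹) (Metric.ball 0 r) :=
  integrableOn_inv_norm_ball volume (by simp) r

instance (r : ℝ) : IsFiniteMeasure (kernelMeasure r) :=
  isFiniteMeasure_withDensity_ofReal (integrableOn_inv_norm_ball_R3 r).2

lemma bond_add (z v v' : R3) : bond z (v + v') = bond z v + bond z v' := by
  simp only [bond, inner_add_right, add_div, add_smul]

lemma bond_smul (z : R3) (c : ℝ) (v : R3) : bond z (c • v) = c • bond z v := by
  simp only [bond, inner_smul_right, mul_div_assoc, mul_smul]

lemma norm_bond_le (z v : R3) : ‖bond z v‖ ≤ ‖z‖⁻¹ * ‖v‖ := by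
  rcases eq_or_ne z 0 with rfl | hz
  · simp [bond]
  calc ‖bond z v‖ = ‖inner ℝ z v‖ / ‖z‖ ^ 3 * ‖z‖ := by
        rw [bond, norm_smul, norm_div, norm_pow, norm_norm]
    _ ≤ ‖z‖ * ‖v‖ / ‖z‖ ^ 3 * ‖z‖ := by gcongr; exact norm_inner_le_norm z v
    _ = ‖z‖⁻¹ * ‖v‖ := by field_simp [norm_ne_zero_iff.2 hz]

variable {r : ℝ}

lemma lintegral_bond_le {v : R3 → R3} (hv : Measurable v) :
    ∫⁻ z in Metric.ball 0 r, ‖bond z (v z)‖ₑ ≤ ∫⁻ z, ‖v z‖ₑ ∂kernelMeasure r := by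
  rw [kernelMeasure, lintegral_withDensity_eq_lintegral_mul _ (by fun_prop) hv.enorm]
  refine lintegral_mono fun z => ?_
  rw [Pi.mul_apply, ← ofReal_norm, ← ofReal_norm, ← ENNReal.ofReal_mul (by positivity)]
  exact ENNReal.ofReal_le_ofReal (norm_bond_le z (v z))

lemma enorm_integral_bond_le {v : R3 → R3} (hv : Measurable v) {C : ℝ≥0∞}
    (hC : ∀ z, ‖v z‖ₑ ≤ C) :
    ‖∫ z in Metric.ball 0 r, bond z (v z)‖ₑ ≤ kernelMeasure r univ * C :=
  calc ‖∫ z in Metric.ball 0 r, bond z (v z)‖ₑ ≤ ∫⁻ z, ‖v z‖ₑ ∂kernelMeasure r :=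
        (enorm_integral_le_lintegral_enorm _).trans (lintegral_bond_le hv)
    _ ≤ ∫⁻ _, C ∂kernelMeasure r := lintegral_mono hC
    _ = kernelMeasure r univ * C := by rw [lintegral_const, mul_comm]

lemma measurable_bond {X : Type*} [MeasurableSpace X] {a v : X → R3} (ha : Measurable a)
    (hv : Measurable v) : Measurable fun q => bond (a q) (v q) := by
  unfold bond
  fun_prop

lemma integrableOn_bond {v : R3 → R3} (hv : Measurable v) {C : ℝ≥0∞} (hC : C ≠ ∞)
    (hvC : ∀ z, ‖v z‖ₑ ≤ C) : IntegrableOn (fun z => bond z (v z)) (Metric.ball 0 r) := by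
  refine ⟨(measurable_bond measurable_id hv).aestronglyMeasurable, ?_⟩
  calc ∫⁻ z in Metric.ball 0 r, ‖bond z (v z)‖ₑ ≤ ∫⁻ z, ‖v z‖ₑ ∂kernelMeasure r :=
        lintegral_bond_le hv
    _ ≤ ∫⁻ _, C ∂kernelMeasure r := lintegral_mono hvC
    _ < ∞ := by
        rw [lintegral_const]
        exact ENNReal.mul_lt_top hC.lt_top (measure_lt_top _ _)

lemma tendsto_integral_bond {ι : Type*} {l : Filter ι} [l.IsCountablyGenerated]
    {v : ι → R3 → R3} (hv : ∀ i, Measurable (v i)) {C : ℝ≥0∞} (hC : C ≠ ∞)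
    (hvC : ∀ i z, ‖v i z‖ₑ ≤ C) (hlim : ∀ z, Tendsto (fun i => v i z) l (𝓝 0)) :
    Tendsto (fun i => ∫ z in Metric.ball 0 r, bond z (v i z)) l (𝓝 0) := by
  have hbound (i : ι) (z : R3) : ‖bond z (v i z)‖ ≤ ‖z‖⁻¹ * C.toReal :=
    (norm_bond_le z _).trans
      (by gcongr; exact toReal_enorm (v i z) ▸ ENNReal.toReal_mono hC (hvC i z))
  have hbond (z : R3) : Tendsto (fun i => bond z (v i z)) l (𝓝 0) :=
    squeeze_zero_norm (fun i => norm_bond_le z (v i z))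
      (by simpa using (hlim z).norm.const_mul ‖z‖⁻¹)
  simpa using tendsto_integral_filter_of_dominated_convergence (fun z => ‖z‖⁻¹ * C.toReal)
    (Eventually.of_forall fun i => (measurable_bond measurable_id (hv i)).aestronglyMeasurable)
    (Eventually.of_forall fun i => Eventually.of_forall (hbound i))
    ((integrableOn_inv_norm_ball_R3 r).mul_const _) (Eventually.of_forall hbond)

variable {V : R3 → R3 → R3}

lemma measurable_integral_bond (hV : Measurable (Function.uncurry V)) :
    Measurable fun x => ∫ z in Metric.ball 0 r, bond z (V x z) :=
  (measurable_bond measurable_snd hV).stronglyMeasurable.integral_prod_right.measurable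

variable {ν : Measure R3} [SFinite ν] {p A : ℝ≥0∞}

lemma eLpNorm_integral_bond_le (hV : Measurable (Function.uncurry V)) (hp1 : 1 ≤ p) (hp : p ≠ ∞)
    (hA : ∀ z, eLpNorm (fun x => V x z) p ν ≤ A) :
    eLpNorm (fun x => ∫ z in Metric.ball 0 r, bond z (V x z)) p ν ≤ kernelMeasure r univ * A := by
  refine (eLpNorm_mono_enorm fun x => ?_).trans
    (eLpNorm_lintegral_le hp1 hp hV.enorm fun z => (eLpNorm_enorm _).trans_le (hA z))
  rw [enorm_eq_self]
  exact (enorm_integral_le_lintegral_enorm _).trans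
    (lintegral_bond_le (hV.comp measurable_prodMk_left))

lemma ae_integrableOn_bond (hV : Measurable (Function.uncurry V)) (hp1 : 1 ≤ p) (hp : p ≠ ∞)
    (hA : ∀ z, eLpNorm (fun x => V x z) p ν ≤ A) (hA' : A ≠ ∞) :
    ∀ᵐ x ∂ν, IntegrableOn (fun z => bond z (V x z)) (Metric.ball 0 r) := by
  have hp0 : p ≠ 0 := (zero_lt_one.trans_le hp1).ne'
  have hm : Measurable fun x => ∫⁻ z, ‖V x z‖ₑ ∂kernelMeasure r := hV.enorm.lintegral_prod_right
  have hfin : eLpNorm (fun x => ∫⁻ z, ‖V x z‖ₑ ∂kernelMeasure r) p ν < ∞ :=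
    (eLpNorm_lintegral_le hp1 hp hV.enorm fun z => (eLpNorm_enorm _).trans_le (hA z)).trans_lt
      (ENNReal.mul_lt_top (measure_lt_top _ _) hA'.lt_top)
  filter_upwards [ae_lt_top (hm.enorm.pow_const _)
    (lintegral_rpow_enorm_lt_top_of_eLpNorm_lt_top hp0 hp hfin).ne] with x hx
  have hVx : Measurable (V x) := hV.comp measurable_prodMk_left
  refine ⟨(measurable_bond measurable_id hVx).aestronglyMeasurable,
    (lintegral_bond_le hVx).trans_lt ?_⟩
  rw [enorm_eq_self] at hx
  exact (ENNReal.rpow_lt_top_iff_of_pos (ENNReal.toReal_pos hp0 hp)).1 hx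

end WeaklySingular

section Coefficients

lemma Body.chi_of_mem {Ω : Body} {x : R3} (h : x ∈ Ω.carrier) : Ω.chi x = 1 :=
  indicator_of_mem h _

lemma Body.nnnorm_chi_le (Ω : Body) (x : R3) : ‖Ω.chi x‖₊ ≤ 1 := by
  by_cases h : x ∈ Ω.carrier <;> simp [Body.chi, h]

lemma Body.nnnorm_one_sub_chi_le (Ω : Body) (x : R3) : ‖1 - Ω.chi x‖₊ ≤ 1 := by
  by_cases h : x ∈ Ω.carrier <;> simp [Body.chi, h]

lemma Body.measurable_chi (Ω : Body) : Measurable Ω.chi :=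
  measurable_const.indicator Ω.isOpen.measurableSet

namespace Medium

variable (M : Medium)

lemma chif_eq_zero_or_one (y : R3) : M.chif y = 0 ∨ M.chif y = 1 := by
  by_cases h : toCell y ∈ M.inclusion <;> simp [chif, h]

lemma measurable_chif : Measurable M.chif :=
  (measurable_const.indicator M.measurableSet_inclusion).comp measurable_toCell

lemma measurable_rho : Measurable M.rho := by
  have := M.measurable_chif
  unfold rho chim
  fun_prop

lemma measurable_alpha : Measurable (Function.uncurry M.alpha) := by
  have := M.measurable_chif
  unfold Function.uncurry alpha chim
  fun_prop

/-- A bound on the bond strength `α`. -/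
def alphaBound : NNReal := ‖M.Cf‖₊ + ‖M.Cm‖₊ + ‖M.Ci‖₊

lemma nnnorm_alpha_le (y y' : R3) : ‖M.alpha y y'‖₊ ≤ M.alphaBound := by
  rcases M.chif_eq_zero_or_one y with h | h <;> rcases M.chif_eq_zero_or_one y' with h' | h' <;>
    simp [alpha, chim, h, h', alphaBound, add_assoc, le_add_left]

/-- A bound on the inverse density `ρ⁻¹`. -/
noncomputable def rhoInvBound : NNReal := ‖M.rhof⁻¹‖₊ + ‖M.rhom⁻¹‖₊

lemma nnnorm_rho_inv_le (y : R3) : ‖(M.rho y)⁻¹‖₊ ≤ M.rhoInvBound := by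
  rcases M.chif_eq_zero_or_one y with h | h <;> simp [rho, chim, h, rhoInvBound]

end Medium

variable (M : Medium) (Ω : Body) (x y y' : R3)

lemma nnnorm_chi_mul_alpha_le : ‖Ω.chi x * M.alpha y y'‖₊ ≤ M.alphaBound :=
  (nnnorm_mul _ _).trans_le
    ((mul_le_mul' (Ω.nnnorm_chi_le x) (M.nnnorm_alpha_le y y')).trans_eq (one_mul _))

lemma nnnorm_one_sub_chi_mul_alpha_le : ‖(1 - Ω.chi x) * M.alpha y y'‖₊ ≤ M.alphaBound :=
  (nnnorm_mul _ _).trans_le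
    ((mul_le_mul' (Ω.nnnorm_one_sub_chi_le x) (M.nnnorm_alpha_le y y')).trans_eq (one_mul _))

lemma nnnorm_chi_mul_lam_le : ‖Ω.chi x * M.lam‖₊ ≤ ‖M.lam‖₊ :=
  (nnnorm_mul _ _).trans_le ((mul_le_mul_left (Ω.nnnorm_chi_le x) _).trans_eq (one_mul _))

end Coefficients

section Stretch

variable (M : Medium) (Ω : Body) (w : R3 → R3 → R3) (ε : ℝ) (x z : R3)

/-- The vector to which the kernel `bond z` is applied in `d_{S,1}^ε(x)`, with the bond strength
and the cut-off at the boundary of the body included. -/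
noncomputable def stretchS1 : R3 :=
  (Ω.chi (x + ε • z) * M.alpha (ε⁻¹ • x) (ε⁻¹ • x + z)) •
    (w (x + ε • z) (ε⁻¹ • x + z) - w x (ε⁻¹ • x + z))

/-- The vector to which the kernel `bond z` is applied in `d_{S,2}^ε(x)`, as in `stretchS1`. -/
noncomputable def stretchS2 : R3 :=
  ((1 - Ω.chi (x + ε • z)) * M.alpha (ε⁻¹ • x) (ε⁻¹ • x + z)) •
    (w x (ε⁻¹ • x + z) - w x (ε⁻¹ • x))

/-- The vector to which the kernel `bond z` is applied in `d_L^ε(x)`, as in `stretchS1`. -/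
noncomputable def stretchL : R3 :=
  (Ω.chi (x + z) * M.lam) • (w (x + z) (ε⁻¹ • (x + z)) - ∫ y in Y, w (x + z) y)

lemma integrandS1_eq_bond : integrandS1 M Ω w ε x = fun z => bond z (stretchS1 M Ω w ε x z) :=
  funext fun _ => (bond_smul _ _ _).symm

lemma integrandS2_eq_bond : integrandS2 M Ω w ε x = fun z => bond z (stretchS2 M Ω w ε x z) :=
  funext fun _ => (bond_smul _ _ _).symm

lemma integrandL_eq_bond : integrandL M Ω w ε x = fun z => bond z (stretchL M Ω w ε x z) :=
  funext fun _ => (bond_smul _ _ _).symm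

lemma dS1_eq_integral_bond :
    dS1 M Ω w ε x = ∫ z in Metric.ball 0 M.del, bond z (stretchS1 M Ω w ε x z) := by
  rw [dS1, integrandS1_eq_bond]

lemma dS2_eq_integral_bond :
    dS2 M Ω w ε x = -∫ z in Metric.ball 0 M.del, bond z (stretchS2 M Ω w ε x z) := by
  rw [dS2, integrandS2_eq_bond]

lemma dL_eq_integral_bond :
    dL M Ω w ε x = ∫ z in Metric.ball 0 M.gam, bond z (stretchL M Ω w ε x z) := by
  rw [dL, integrandL_eq_bond]

variable {w}

lemma measurable_stretchS1 (hw : Measurable (Function.uncurry w)) :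
    Measurable (Function.uncurry (stretchS1 M Ω w ε)) := by
  have hχ : Measurable fun q : R3 × R3 => Ω.chi (q.1 + ε • q.2) :=
    Ω.measurable_chi.comp (by fun_prop)
  have hα : Measurable fun q : R3 × R3 => M.alpha (ε⁻¹ • q.1) (ε⁻¹ • q.1 + q.2) :=
    M.measurable_alpha.comp (f := fun q : R3 × R3 => (ε⁻¹ • q.1, ε⁻¹ • q.1 + q.2)) (by fun_prop)
  have hw₁ : Measurable fun q : R3 × R3 => w (q.1 + ε • q.2) (ε⁻¹ • q.1 + q.2) :=
    hw.comp (f := fun q : R3 × R3 => (q.1 + ε • q.2, ε⁻¹ • q.1 + q.2)) (by fun_prop)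
  have hw₂ : Measurable fun q : R3 × R3 => w q.1 (ε⁻¹ • q.1 + q.2) :=
    hw.comp (f := fun q : R3 × R3 => (q.1, ε⁻¹ • q.1 + q.2)) (by fun_prop)
  exact (hχ.mul hα).smul (hw₁.sub hw₂)

lemma measurable_stretchS2 (hw : Measurable (Function.uncurry w)) :
    Measurable (Function.uncurry (stretchS2 M Ω w ε)) := by
  have hχ : Measurable fun q : R3 × R3 => Ω.chi (q.1 + ε • q.2) :=
    Ω.measurable_chi.comp (by fun_prop)
  have hα : Measurable fun q : R3 × R3 => M.alpha (ε⁻¹ • q.1) (ε⁻¹ • q.1 + q.2) :=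
    M.measurable_alpha.comp (f := fun q : R3 × R3 => (ε⁻¹ • q.1, ε⁻¹ • q.1 + q.2)) (by fun_prop)
  have hw₁ : Measurable fun q : R3 × R3 => w q.1 (ε⁻¹ • q.1 + q.2) :=
    hw.comp (f := fun q : R3 × R3 => (q.1, ε⁻¹ • q.1 + q.2)) (by fun_prop)
  have hw₂ : Measurable fun q : R3 × R3 => w q.1 (ε⁻¹ • q.1) :=
    hw.comp (f := fun q : R3 × R3 => (q.1, ε⁻¹ • q.1)) (by fun_prop)
  exact ((hχ.const_sub 1).mul hα).smul (hw₁.sub hw₂)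

lemma measurable_stretchL (hw : Measurable (Function.uncurry w)) :
    Measurable (Function.uncurry (stretchL M Ω w ε)) := by
  have hχ : Measurable fun q : R3 × R3 => Ω.chi (q.1 + q.2) := Ω.measurable_chi.comp (by fun_prop)
  have hw₁ : Measurable fun q : R3 × R3 => w (q.1 + q.2) (ε⁻¹ • (q.1 + q.2)) :=
    hw.comp (f := fun q : R3 × R3 => (q.1 + q.2, ε⁻¹ • (q.1 + q.2))) (by fun_prop)
  have hmean : Measurable fun x => ∫ y in Y, w x y :=
    hw.stronglyMeasurable.integral_prod_right.measurable
  exact (hχ.mul_const M.lam).smul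
    (hw₁.sub (hmean.comp (measurable_fst.add measurable_snd)))

lemma measurable_forcing (hw : Measurable (Function.uncurry w)) :
    Measurable (forcing M Ω w ε) := by
  have hρ : Measurable fun x : R3 => (M.rho (ε⁻¹ • x))⁻¹ :=
    (M.measurable_rho.comp (measurable_const_smul ε⁻¹)).inv
  change Measurable fun x => forcing M Ω w ε x
  simp only [forcing, dS1_eq_integral_bond, dS2_eq_integral_bond, dL_eq_integral_bond]
  exact hρ.smul (((measurable_integral_bond (measurable_stretchS1 M Ω ε hw)).add
    (measurable_integral_bond (measurable_stretchS2 M Ω ε hw)).neg).add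
    (measurable_integral_bond (measurable_stretchL M Ω ε hw)))

end Stretch

section Bounds

variable {F : Type*} [NormedAddCommGroup F] [NormedSpace ℝ F]

lemma enorm_smul_sub_le {c : ℝ} {C : NNReal} (hc : ‖c‖₊ ≤ C) {v v' : F} {A : ℝ≥0∞}
    (hv : ‖v‖ₑ ≤ A) (hv' : ‖v'‖ₑ ≤ A) : ‖c • (v - v')‖ₑ ≤ C * (2 * A) := by
  rw [enorm_smul, two_mul]
  gcongr
  · exact ENNReal.coe_le_coe.2 hc
  · exact enorm_sub_le.trans (add_le_add hv hv')

lemma eLpNorm_smul_sub_le {X : Type*} [MeasurableSpace X] {ν : Measure X} {p : ℝ≥0∞} (hp1 : 1 ≤ p)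
    {c : X → ℝ} {C : NNReal} (hc : ∀ x, ‖c x‖₊ ≤ C) {g g' : X → F}
    (hg : AEStronglyMeasurable g ν) (hg' : AEStronglyMeasurable g' ν) {A : ℝ≥0∞}
    (hgA : eLpNorm g p ν ≤ A) (hgA' : eLpNorm g' p ν ≤ A) :
    eLpNorm (fun x => c x • (g x - g' x)) p ν ≤ C * (2 * A) := by
  have hle : eLpNorm (fun x => c x • (g x - g' x)) p ν ≤ C • eLpNorm (g - g') p ν :=
    eLpNorm_le_nnreal_smul_eLpNorm_of_ae_le_mul (Eventually.of_forall fun x => by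
      rw [nnnorm_smul, Pi.sub_apply]
      gcongr
      exact hc x) p
  refine hle.trans ?_
  rw [two_mul]
  exact mul_le_mul_right ((eLpNorm_sub_le hg hg' hp1).trans (add_le_add hgA hgA')) _

/-- The norm of the operator `w ↦ d^ε` is bounded by this constant, for bounded fields in the
supremum norm and, up to the factor `Body.oscBound`, in `L^p`. -/
noncomputable def Medium.forcingBound (M : Medium) : ℝ≥0∞ :=
  2 * M.rhoInvBound *
    (2 * kernelMeasure M.del univ * M.alphaBound + kernelMeasure M.gam univ * ‖M.lam‖₊)

lemma Medium.forcingBound_ne_top (M : Medium) : M.forcingBound ≠ ∞ := by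
  unfold Medium.forcingBound
  finiteness

lemma Medium.forcingBound_mul (M : Medium) (A : ℝ≥0∞) :
    M.rhoInvBound * (kernelMeasure M.del univ * (M.alphaBound * (2 * A))
      + kernelMeasure M.del univ * (M.alphaBound * (2 * A))
      + kernelMeasure M.gam univ * (‖M.lam‖₊ * (2 * A))) = M.forcingBound * A := by
  rw [Medium.forcingBound]
  ring

lemma enorm_forcing_le (M : Medium) (Ω : Body) {w : R3 → R3 → R3}
    (hw : Measurable (Function.uncurry w)) {B : ℝ≥0∞} (hB : ∀ x y, ‖w x y‖ₑ ≤ B) (ε : ℝ) (x : R3) :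
    ‖forcing M Ω w ε x‖ₑ ≤ M.forcingBound * B := by
  have hmean (x : R3) : ‖∫ y in Y, w x y‖ₑ ≤ B :=
    (enorm_integral_le_lintegral_enorm _).trans
      ((lintegral_mono fun y => hB x y).trans_eq (by simp))
  rw [forcing, enorm_smul, dS1_eq_integral_bond, dS2_eq_integral_bond, dL_eq_integral_bond,
    ← M.forcingBound_mul]
  refine mul_le_mul' (ENNReal.coe_le_coe.2 (M.nnnorm_rho_inv_le _))
    ((enorm_add_le _ _).trans (add_le_add ((enorm_add_le _ _).trans (add_le_add ?_ ?_)) ?_))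
  · exact enorm_integral_bond_le (measurable_stretchS1 M Ω ε hw).of_uncurry_left
      fun z => enorm_smul_sub_le (nnnorm_chi_mul_alpha_le M Ω _ _ _) (hB _ _) (hB _ _)
  · rw [enorm_neg]
    exact enorm_integral_bond_le (measurable_stretchS2 M Ω ε hw).of_uncurry_left
      fun z => enorm_smul_sub_le (nnnorm_one_sub_chi_mul_alpha_le M Ω _ _ _) (hB _ _) (hB _ _)
  · exact enorm_integral_bond_le (measurable_stretchL M Ω ε hw).of_uncurry_left
      fun z => enorm_smul_sub_le (nnnorm_chi_mul_lam_le M Ω _) (hB _ _) (hmean _)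

end Bounds

section Field

variable {Ω : Body}

open Classical in
/-- The extension by zero of a continuous function on `Ω̄`. -/
noncomputable def zeroExtend (g : C(closure Ω.carrier, R3)) (x : R3) : R3 :=
  if h : x ∈ closure Ω.carrier then g ⟨x, h⟩ else 0

/-- The two-scale field `(x, y) ↦ f(y)(x)` given by a function `f` of the fast variable with
values in `C(Ω̄)³`, extended periodically in `y` and by zero in `x`. -/
noncomputable def field (f : R3 → C(closure Ω.carrier, R3)) (x y : R3) : R3 :=
  zeroExtend (f (toCell y)) x

lemma norm_zeroExtend_le (g : C(closure Ω.carrier, R3)) (x : R3) : ‖zeroExtend g x‖ ≤ ‖g‖ := by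
  unfold zeroExtend
  split_ifs
  · exact g.norm_coe_le_norm _
  · simp

lemma enorm_field_le (f : R3 → C(closure Ω.carrier, R3)) (x y : R3) :
    ‖field f x y‖ₑ ≤ ‖f (toCell y)‖ₑ :=
  enorm_le_iff_norm_le.2 (norm_zeroExtend_le _ _)

lemma lintegral_enorm_field_le (f : R3 → C(closure Ω.carrier, R3)) (x : R3) :
    ∫⁻ y in Y, ‖field f x y‖ₑ ≤ ∫⁻ y in Y, ‖f y‖ₑ :=
  setLIntegral_mono' measurableSet_Y fun y hy =>
    (enorm_field_le f x y).trans_eq (by rw [toCell_of_mem_Y hy])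

variable {f : R3 → C(closure Ω.carrier, R3)} (hf : StronglyMeasurable f)
include hf

lemma measurable_field : Measurable (Function.uncurry (field f)) := by
  classical
  have hs : MeasurableSet {q : R3 × R3 | q.1 ∈ closure Ω.carrier} :=
    isClosed_closure.measurableSet.preimage measurable_fst
  have hfst : StronglyMeasurable fun q : {q : R3 × R3 | q.1 ∈ closure Ω.carrier} =>
      (⟨q.1.1, q.2⟩ : closure Ω.carrier) :=
    ((measurable_fst.comp measurable_subtype_coe).subtype_mk).stronglyMeasurable
  have hval : StronglyMeasurable fun q : {q : R3 × R3 | q.1 ∈ closure Ω.carrier} =>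
      f (toCell q.1.2) ⟨q.1.1, q.2⟩ :=
    (ContinuousEval.continuous_eval (F := C(closure Ω.carrier, R3))).comp_stronglyMeasurable
      ((hf.comp_measurable
        (measurable_toCell.comp (measurable_snd.comp measurable_subtype_coe))).prodMk hfst)
  exact Measurable.dite hval.measurable measurable_const hs

lemma aestronglyMeasurable_field_comp {X : Type*} [MeasurableSpace X] {ν : Measure X}
    {a b : X → R3} (ha : Measurable a) (hb : Measurable b) :
    AEStronglyMeasurable (fun x => field f (a x) (b x)) ν :=
  ((measurable_field hf).comp (ha.prodMk hb)).aestronglyMeasurable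

lemma integrableOn_field (hf1 : MemLp f 1 (volume.restrict Y)) (x : R3) :
    IntegrableOn (field f x) Y :=
  ⟨aestronglyMeasurable_field_comp hf measurable_const measurable_id,
    (lintegral_enorm_field_le f x).trans_lt (memLp_one_iff_integrable.1 hf1).2⟩

variable {p : ℝ≥0∞} (hp : p ≠ ∞) {ε : ℝ} (hε : 0 < ε) (hε1 : ε ≤ 1)
include hp hε hε1

lemma eLpNorm_field_oscillation_le (a : R3 → R3) (z : R3) :
    eLpNorm (fun x => field f (a x) (ε⁻¹ • x + z)) p (volume.restrict Ω.carrier)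
      ≤ Ω.oscBound p * eLpNorm f p (volume.restrict Y) :=
  (eLpNorm_mono_enorm fun _ => enorm_field_le f _ _).trans
    (eLpNorm_oscillation_le Ω hf hp hε hε1 z)

variable (hp1 : 1 ≤ p)
include hp1

lemma eLpNorm_cellMean_le (a : R3 → R3) :
    eLpNorm (fun x => ∫ y in Y, field f (a x) y) p (volume.restrict Ω.carrier)
      ≤ Ω.oscBound p * eLpNorm f p (volume.restrict Y) := by
  have hmean (x : R3) : ‖∫ y in Y, field f (a x) y‖ₑ ≤ eLpNorm f p (volume.restrict Y) :=
    calc ‖∫ y in Y, field f (a x) y‖ₑ ≤ ∫⁻ y in Y, ‖f y‖ₑ :=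
          (enorm_integral_le_lintegral_enorm _).trans (lintegral_enorm_field_le f (a x))
      _ = eLpNorm f 1 (volume.restrict Y) := eLpNorm_one_eq_lintegral_enorm.symm
      _ ≤ eLpNorm f p (volume.restrict Y) :=
          eLpNorm_le_eLpNorm_of_exponent_le hp1 hf.aestronglyMeasurable
  set A := eLpNorm f p (volume.restrict Y)
  calc eLpNorm (fun x => ∫ y in Y, field f (a x) y) p (volume.restrict Ω.carrier)
      ≤ eLpNorm (fun _ => A) p (volume.restrict Ω.carrier) := eLpNorm_mono_enorm hmean
    _ ≤ Ω.oscBound p * eLpNorm (fun _ => A) p (volume.restrict Y) :=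
        eLpNorm_oscillation_le Ω (f := fun _ => A) stronglyMeasurable_const hp hε hε1 0
    _ = Ω.oscBound p * A := by
        rw [eLpNorm_const _ (zero_lt_one.trans_le hp1).ne' (NeZero.ne _), measure_univ,
          ENNReal.one_rpow, mul_one, enorm_eq_self]

end Field

section FieldBounds

variable (M : Medium) {Ω : Body} {f : R3 → C(closure Ω.carrier, R3)} (hf : StronglyMeasurable f)
  {p : ℝ≥0∞} (hp1 : 1 ≤ p) (hp : p ≠ ∞) {ε : ℝ} (hε : 0 < ε) (hε1 : ε ≤ 1)
include hf hp1 hp hε hε1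

lemma eLpNorm_stretchS1_field_le (z : R3) :
    eLpNorm (fun x => stretchS1 M Ω (field f) ε x z) p (volume.restrict Ω.carrier)
      ≤ M.alphaBound * (2 * (Ω.oscBound p * eLpNorm f p (volume.restrict Y))) :=
  eLpNorm_smul_sub_le hp1 (fun _ => nnnorm_chi_mul_alpha_le M Ω _ _ _)
    (aestronglyMeasurable_field_comp hf (by fun_prop) (by fun_prop))
    (aestronglyMeasurable_field_comp hf (by fun_prop) (by fun_prop))
    (eLpNorm_field_oscillation_le hf hp hε hε1 (fun x => x + ε • z) z)
    (eLpNorm_field_oscillation_le hf hp hε hε1 id z)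

lemma eLpNorm_stretchS2_field_le (z : R3) :
    eLpNorm (fun x => stretchS2 M Ω (field f) ε x z) p (volume.restrict Ω.carrier)
      ≤ M.alphaBound * (2 * (Ω.oscBound p * eLpNorm f p (volume.restrict Y))) :=
  eLpNorm_smul_sub_le hp1 (fun _ => nnnorm_one_sub_chi_mul_alpha_le M Ω _ _ _)
    (aestronglyMeasurable_field_comp hf (by fun_prop) (by fun_prop))
    (aestronglyMeasurable_field_comp hf (by fun_prop) (by fun_prop))
    (eLpNorm_field_oscillation_le hf hp hε hε1 id z)
    (by simpa only [add_zero, id] using eLpNorm_field_oscillation_le hf hp hε hε1 id 0)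

lemma eLpNorm_stretchL_field_le (z : R3) :
    eLpNorm (fun x => stretchL M Ω (field f) ε x z) p (volume.restrict Ω.carrier)
      ≤ ‖M.lam‖₊ * (2 * (Ω.oscBound p * eLpNorm f p (volume.restrict Y))) :=
  eLpNorm_smul_sub_le hp1 (fun _ => nnnorm_chi_mul_lam_le M Ω _)
    (aestronglyMeasurable_field_comp hf (by fun_prop) (by fun_prop))
    ((measurable_field hf).stronglyMeasurable.integral_prod_right.comp_measurable
      (measurable_add_const z)).aestronglyMeasurable
    (by simpa only [smul_add] using
      eLpNorm_field_oscillation_le hf hp hε hε1 (fun x => x + z) (ε⁻¹ • z))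
    (eLpNorm_cellMean_le hf hp hε hε1 hp1 (fun x => x + z))

lemma eLpNorm_forcing_field_le :
    eLpNorm (forcing M Ω (field f) ε) p (volume.restrict Ω.carrier)
      ≤ M.forcingBound * (Ω.oscBound p * eLpNorm f p (volume.restrict Y)) := by
  have hw := measurable_field hf
  have hS1 := eLpNorm_integral_bond_le (r := M.del) (measurable_stretchS1 M Ω ε hw) hp1 hp
    (eLpNorm_stretchS1_field_le M hf hp1 hp hε hε1)
  have hS2 := eLpNorm_integral_bond_le (r := M.del) (measurable_stretchS2 M Ω ε hw) hp1 hp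
    (eLpNorm_stretchS2_field_le M hf hp1 hp hε hε1)
  have hL := eLpNorm_integral_bond_le (r := M.gam) (measurable_stretchL M Ω ε hw) hp1 hp
    (eLpNorm_stretchL_field_le M hf hp1 hp hε hε1)
  rw [← eLpNorm_neg] at hS2
  have hmS1 := measurable_integral_bond (r := M.del) (measurable_stretchS1 M Ω ε hw)
  have hmS2 := (measurable_integral_bond (r := M.del) (measurable_stretchS2 M Ω ε hw)).neg
  have hmL := measurable_integral_bond (r := M.gam) (measurable_stretchL M Ω ε hw)
  rw [← M.forcingBound_mul]
  refine (eLpNorm_le_nnreal_smul_eLpNorm_of_ae_le_mul (Eventually.of_forall fun x => ?_) p).trans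
    (mul_le_mul_right ((eLpNorm_add_le (hmS1.add hmS2).aestronglyMeasurable
      hmL.aestronglyMeasurable hp1).trans (add_le_add ((eLpNorm_add_le hmS1.aestronglyMeasurable
        hmS2.aestronglyMeasurable hp1).trans (add_le_add hS1 hS2)) hL)) _)
  rw [forcing, nnnorm_smul, dS1_eq_integral_bond, dS2_eq_integral_bond, dL_eq_integral_bond]
  exact mul_le_mul_left (M.nnnorm_rho_inv_le _) _

lemma ae_forcingConverges_field (hfp : MemLp f p (volume.restrict Y)) :
    ∀ᵐ x ∂volume.restrict Ω.carrier, ForcingConverges M Ω (field f) ε x := by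
  have hw := measurable_field hf
  have hfin : Ω.oscBound p * eLpNorm f p (volume.restrict Y) ≠ ∞ :=
    ENNReal.mul_ne_top (Ω.oscBound_ne_top p) hfp.2.ne
  simp only [ForcingConverges, integrandS1_eq_bond, integrandS2_eq_bond, integrandL_eq_bond]
  filter_upwards [
    ae_integrableOn_bond (r := M.del) (measurable_stretchS1 M Ω ε hw) hp1 hp
      (eLpNorm_stretchS1_field_le M hf hp1 hp hε hε1) (by finiteness),
    ae_integrableOn_bond (r := M.del) (measurable_stretchS2 M Ω ε hw) hp1 hp
      (eLpNorm_stretchS2_field_le M hf hp1 hp hε hε1) (by finiteness),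
    ae_integrableOn_bond (r := M.gam) (measurable_stretchL M Ω ε hw) hp1 hp
      (eLpNorm_stretchL_field_le M hf hp1 hp hε hε1) (by finiteness)] with x hS1 hS2 hL
  exact ⟨hS1, hS2, hL⟩

lemma memLp_forcing_field (hfp : MemLp f p (volume.restrict Y)) :
    MemLp (forcing M Ω (field f) ε) p (volume.restrict Ω.carrier) :=
  ⟨(measurable_forcing M Ω ε (measurable_field hf)).aestronglyMeasurable,
    (eLpNorm_forcing_field_le M hf hp1 hp hε hε1).trans_lt
      (ENNReal.mul_lt_top M.forcingBound_ne_top.lt_top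
        (ENNReal.mul_lt_top (Ω.oscBound_ne_top p).lt_top hfp.2))⟩

end FieldBounds

section Linearity

lemma eLpNorm_sub_eq_zero_of_ae_eq {X F : Type*} [MeasurableSpace X] [NormedAddCommGroup F]
    {ν : Measure X} {g f : X → F} (hgf : g =ᵐ[ν] f) {p : ℝ≥0∞} : eLpNorm (g - f) p ν = 0 :=
  eLpNorm_eq_zero_of_ae_zero <| by
    filter_upwards [hgf] with x hx using sub_eq_zero.2 hx

variable (M : Medium) (Ω : Body) {w w' : R3 → R3 → R3} {ε : ℝ} {x : R3}

lemma integrandS1_add :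
    integrandS1 M Ω (w + w') ε x = integrandS1 M Ω w ε x + integrandS1 M Ω w' ε x := by
  ext1 z
  simp only [integrandS1, Pi.add_apply, ← smul_add, ← bond_add, add_sub_add_comm]

lemma integrandS2_add :
    integrandS2 M Ω (w + w') ε x = integrandS2 M Ω w ε x + integrandS2 M Ω w' ε x := by
  ext1 z
  simp only [integrandS2, Pi.add_apply, ← smul_add, ← bond_add, add_sub_add_comm]

lemma integrandL_add (hw : ∀ x, IntegrableOn (w x) Y) (hw' : ∀ x, IntegrableOn (w' x) Y) :
    integrandL M Ω (w + w') ε x = integrandL M Ω w ε x + integrandL M Ω w' ε x := by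
  ext1 z
  simp only [integrandL, Pi.add_apply, ← smul_add, ← bond_add, integral_add (hw _) (hw' _),
    add_sub_add_comm]

lemma forcing_add (hw : ∀ x, IntegrableOn (w x) Y) (hw' : ∀ x, IntegrableOn (w' x) Y)
    (h : ForcingConverges M Ω w ε x) (h' : ForcingConverges M Ω w' ε x) :
    forcing M Ω (w + w') ε x = forcing M Ω w ε x + forcing M Ω w' ε x := by
  simp only [forcing, dS1, dS2, dL, integrandS1_add, integrandS2_add, integrandL_add M Ω hw hw',
    integral_add' h.1 h'.1, integral_add' h.2.1 h'.2.1, integral_add' h.2.2 h'.2.2, ← smul_add]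
  congr 1
  abel

lemma forcing_smul (c : ℝ) : forcing M Ω (c • w) ε x = c • forcing M Ω w ε x := by
  simp only [forcing, dS1, dS2, dL, integrandS1, integrandS2, integrandL, Pi.smul_apply,
    integral_smul, ← smul_sub, bond_smul, smul_comm _ c, ← smul_neg, ← smul_add]

variable {Ω} {f g : R3 → C(closure Ω.carrier, R3)}

lemma field_add : field (f + g) = field f + field g := by
  ext1 x
  ext1 y
  simp only [field, zeroExtend, Pi.add_apply]
  split_ifs <;> simp

lemma field_smul (c : ℝ) : field (c • f) = c • field f := by
  ext1 x
  ext1 y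
  simp only [field, zeroExtend, Pi.smul_apply]
  split_ifs <;> simp

variable (hf : StronglyMeasurable f) (hg : StronglyMeasurable g) {p : ℝ≥0∞} (hp1 : 1 ≤ p)
  (hp : p ≠ ∞) (hε : 0 < ε) (hε1 : ε ≤ 1) (hfp : MemLp f p (volume.restrict Y))
include hf hg hp1 hp hε hε1 hfp

lemma forcing_field_add_ae (hgp : MemLp g p (volume.restrict Y)) :
    forcing M Ω (field (f + g)) ε =ᵐ[volume.restrict Ω.carrier]
      forcing M Ω (field f) ε + forcing M Ω (field g) ε := by
  rw [field_add]
  filter_upwards [ae_forcingConverges_field M hf hp1 hp hε hε1 hfp,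
    ae_forcingConverges_field M hg hp1 hp hε hε1 hgp] with x hx hx'
  exact forcing_add M Ω (integrableOn_field hf (hfp.mono_exponent hp1))
    (integrableOn_field hg (hgp.mono_exponent hp1)) hx hx'

lemma forcing_field_congr_ae (hfg : g =ᵐ[volume.restrict Y] f) :
    forcing M Ω (field g) ε =ᵐ[volume.restrict Ω.carrier] forcing M Ω (field f) ε := by
  have hsub : eLpNorm (g - f) p (volume.restrict Y) = 0 := eLpNorm_sub_eq_zero_of_ae_eq hfg
  have hnull : forcing M Ω (field (g - f)) ε =ᵐ[volume.restrict Ω.carrier] 0 := by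
    refine (eLpNorm_eq_zero_iff (measurable_forcing M Ω ε
      (measurable_field (hg.sub hf))).aestronglyMeasurable (zero_lt_one.trans_le hp1).ne').1 ?_
    have hle := eLpNorm_forcing_field_le M (hg.sub hf) hp1 hp hε hε1
    simpa only [hsub, mul_zero, nonpos_iff_eq_zero] using hle
  have hadd := forcing_field_add_ae M hf (hg.sub hf) hp1 hp hε hε1 hfp
    ⟨(hg.sub hf).aestronglyMeasurable, hsub.trans_lt ENNReal.zero_lt_top⟩
  rw [add_sub_cancel] at hadd
  filter_upwards [hadd, hnull] with x hx hx0
  rw [hx, Pi.add_apply, hx0, Pi.zero_apply, add_zero]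

end Linearity

section Operator

variable (M : Medium) {Ω : Body} {p : ℝ≥0∞} [Fact (1 ≤ p)] (hp : p ≠ ∞) (ε : Ioc (0 : ℝ) 1)

include hp in
lemma memLp_forcing_eval (w : LpPer Ω p) :
    MemLp (forcing M Ω (LpPer.eval w) ε) p (volume.restrict Ω.carrier) :=
  memLp_forcing_field M (Lp.stronglyMeasurable w) Fact.out hp ε.2.1 ε.2.2 (Lp.memLp w)

include hp in
lemma forcing_eval_add_ae (w w' : LpPer Ω p) :
    forcing M Ω (LpPer.eval (w + w')) ε =ᵐ[volume.restrict Ω.carrier]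
      forcing M Ω (LpPer.eval w) ε + forcing M Ω (LpPer.eval w') ε :=
  have hw := Lp.stronglyMeasurable w
  have hw' := Lp.stronglyMeasurable w'
  (forcing_field_congr_ae M (hw.add hw') (Lp.stronglyMeasurable (w + w')) Fact.out hp ε.2.1 ε.2.2
    ((Lp.memLp w).add (Lp.memLp w')) (Lp.coeFn_add w w')).trans
    (forcing_field_add_ae M hw hw' Fact.out hp ε.2.1 ε.2.2 (Lp.memLp w) (Lp.memLp w'))

include hp in
lemma forcing_eval_smul_ae (c : ℝ) (w : LpPer Ω p) :
    forcing M Ω (LpPer.eval (c • w)) ε =ᵐ[volume.restrict Ω.carrier]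
      c • forcing M Ω (LpPer.eval w) ε := by
  have hcongr := forcing_field_congr_ae M ((Lp.stronglyMeasurable w).const_smul c)
    (Lp.stronglyMeasurable (c • w)) Fact.out hp ε.2.1 ε.2.2 ((Lp.memLp w).const_smul c)
    (Lp.coeFn_smul c w)
  filter_upwards [hcongr] with x hx
  exact hx.trans (by rw [field_smul, forcing_smul]; rfl)

/-- The operator `w ↦ d^ε` from `L^p_per(Y; C(Ω̄)³)` to `L^p(Ω)³` that maps a two-scale field to its
forcing term. -/
noncomputable def forcingCLM : LpPer Ω p →L[ℝ] Lp R3 p (volume.restrict Ω.carrier) :=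
  LinearMap.mkContinuous
    { toFun := fun w => (memLp_forcing_eval M hp ε w).toLp
      map_add' := fun w w' => (MemLp.toLp_congr _ _ (forcing_eval_add_ae M hp ε w w')).trans
        (MemLp.toLp_add (memLp_forcing_eval M hp ε w) (memLp_forcing_eval M hp ε w'))
      map_smul' := fun c w => (MemLp.toLp_congr _ _ (forcing_eval_smul_ae M hp ε c w)).trans
        (MemLp.toLp_const_smul c (memLp_forcing_eval M hp ε w)) }
    (M.forcingBound * Ω.oscBound p).toReal fun w => by
      rw [LinearMap.coe_mk, AddHom.coe_mk, Lp.norm_toLp, Lp.norm_def, ← ENNReal.toReal_mul,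
        mul_assoc]
      exact ENNReal.toReal_mono (ENNReal.mul_ne_top M.forcingBound_ne_top
        (ENNReal.mul_ne_top (Ω.oscBound_ne_top p) (Lp.eLpNorm_ne_top w)))
        (eLpNorm_forcing_field_le M (Lp.stronglyMeasurable w) Fact.out hp ε.2.1 ε.2.2)

lemma coeFn_forcingCLM (w : LpPer Ω p) :
    forcingCLM M hp ε w =ᵐ[volume.restrict Ω.carrier] forcing M Ω (LpPer.eval w) ε :=
  MemLp.coeFn_toLp (memLp_forcing_eval M hp ε w)

lemma norm_forcingCLM_le :
    ‖(forcingCLM M hp ε : LpPer Ω p →L[ℝ] Lp R3 p (volume.restrict Ω.carrier))‖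
      ≤ (M.forcingBound * Ω.oscBound p).toReal :=
  LinearMap.mkContinuous_norm_le _ ENNReal.toReal_nonneg _

end Operator

section DominatedConvergence

lemma tendsto_eLpNorm_of_bounded {X ι F : Type*} [MeasurableSpace X] [NormedAddCommGroup F]
    {ν : Measure X} [IsFiniteMeasure ν] {l : Filter ι} [l.IsCountablyGenerated] {f : ι → X → F}
    {p B : ℝ≥0∞} (hp : p ≠ ∞) (hf : ∀ i, AEStronglyMeasurable (f i) ν) (hB : B ≠ ∞)
    (hfB : ∀ i x, ‖f i x‖ₑ ≤ B) (hlim : ∀ᵐ x ∂ν, Tendsto (fun i => f i x) l (𝓝 0)) :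
    Tendsto (fun i => eLpNorm (f i) p ν) l (𝓝 0) := by
  rcases eq_or_ne p 0 with rfl | hp0
  · simp [tendsto_const_nhds]
  have hP : 0 < p.toReal := ENNReal.toReal_pos hp0 hp
  have hpow {q : ℝ} (hq : 0 < q) : Tendsto (fun a : ℝ≥0∞ => a ^ q) (𝓝 0) (𝓝 0) := by
    simpa [hq] using (ENNReal.continuous_rpow_const (y := q)).tendsto 0
  have hbound : ∫⁻ _, B ^ p.toReal ∂ν ≠ ∞ := by
    rw [lintegral_const]
    exact ENNReal.mul_ne_top (ENNReal.rpow_ne_top_of_nonneg hP.le hB) (measure_ne_top _ _)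
  have hlint : Tendsto (fun i => ∫⁻ x, ‖f i x‖ₑ ^ p.toReal ∂ν) l (𝓝 0) := by
    rw [← lintegral_zero (μ := ν)]
    refine tendsto_lintegral_filter_of_dominated_convergence' (fun _ => B ^ p.toReal)
      (Eventually.of_forall fun i => (hf i).enorm.pow_const _)
      (Eventually.of_forall fun i => Eventually.of_forall fun x =>
        ENNReal.rpow_le_rpow (hfB i x) hP.le) hbound ?_
    filter_upwards [hlim] with x hx
    exact (hpow hP).comp (by simpa using hx.enorm)
  simp only [eLpNorm_eq_lintegral_rpow_enorm_toReal hp0 hp]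
  exact (hpow (one_div_pos.2 hP)).comp hlint

end DominatedConvergence

section Limit

variable {Ω : Body}

lemma measurable_zeroExtend (g : C(closure Ω.carrier, R3)) : Measurable (zeroExtend g) := by
  classical
  exact Measurable.dite g.continuous.measurable measurable_const isClosed_closure.measurableSet

lemma continuousAt_zeroExtend (g : C(closure Ω.carrier, R3)) {x : R3} (hx : x ∈ Ω.carrier) :
    ContinuousAt (zeroExtend g) x := by
  have h : ContinuousOn (zeroExtend g) (closure Ω.carrier) := by
    rw [continuousOn_iff_continuous_domRestrict]
    refine g.continuous.congr fun y => ?_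
    simp [zeroExtend, y.2]
  exact h.continuousAt (mem_of_superset (Ω.isOpen.mem_nhds hx) subset_closure)

lemma tendsto_add_smul (x z : R3) : Tendsto (fun ε : ℝ => x + ε • z) (𝓝[>] 0) (𝓝 x) := by
  have : Continuous fun ε : ℝ => x + ε • z := by fun_prop
  simpa using (this.tendsto 0).mono_left nhdsWithin_le_nhds

lemma tendsto_dS2 (M : Medium) {w : R3 → R3 → R3} (hw : Measurable (Function.uncurry w))
    {B : ℝ≥0∞} (hB : B ≠ ∞) (hwB : ∀ x y, ‖w x y‖ₑ ≤ B) {x : R3} (hx : x ∈ Ω.carrier) :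
    Tendsto (fun ε => dS2 M Ω w ε x) (𝓝[>] 0) (𝓝 0) := by
  have hint : Tendsto (fun ε => ∫ z in Metric.ball 0 M.del, bond z (stretchS2 M Ω w ε x z))
      (𝓝[>] 0) (𝓝 0) := by
    refine tendsto_integral_bond
      (fun ε => (measurable_stretchS2 M Ω ε hw).of_uncurry_left)
      (C := M.alphaBound * (2 * B)) (by finiteness) (fun ε z =>
        enorm_smul_sub_le (nnnorm_one_sub_chi_mul_alpha_le M Ω _ _ _) (hwB _ _) (hwB _ _))
      fun z => tendsto_const_nhds.congr' ?_
    filter_upwards [(tendsto_add_smul x z).eventually (Ω.isOpen.mem_nhds hx)] with ε hε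
    rw [stretchS2, Body.chi_of_mem hε, sub_self, zero_mul, zero_smul]
  simpa only [dS2_eq_integral_bond, neg_zero] using hint.neg

/-- The two-scale field `(x, y) ↦ φ(y) G(x)`, with `φ` extended periodically from the period
cube. -/
noncomputable def separatedField (φ : R3 → ℝ) (G : R3 → R3) (x y : R3) : R3 := φ (toCell y) • G x

variable (M : Medium) {φ : R3 → ℝ} {G : R3 → R3} {B C : ℝ}

lemma enorm_separatedField_le (hφB : ∀ y, |φ y| ≤ B) (hGC : ∀ x, ‖G x‖ ≤ C) (x y : R3) :
    ‖separatedField φ G x y‖ₑ ≤ ENNReal.ofReal (B * C) := by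
  rw [← ofReal_norm, separatedField, norm_smul]
  exact ENNReal.ofReal_le_ofReal
    (mul_le_mul (hφB _) (hGC x) (norm_nonneg _) ((abs_nonneg _).trans (hφB 0)))

lemma setIntegral_separatedField (φ : R3 → ℝ) (G : R3 → R3) (x : R3) :
    ∫ y in Y, separatedField φ G x y = (∫ y in Y, φ y) • G x := by
  rw [← integral_smul_const]
  exact setIntegral_congr_fun measurableSet_Y fun y hy => by
    rw [separatedField, toCell_of_mem_Y hy]

variable (hφ : Measurable φ) (hφB : ∀ y, |φ y| ≤ B) (hG : Measurable G) (hGC : ∀ x, ‖G x‖ ≤ C)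

include hφ hG in
lemma measurable_separatedField : Measurable (Function.uncurry (separatedField φ G)) :=
  (hφ.comp (measurable_toCell.comp measurable_snd)).smul (hG.comp measurable_fst)

include hφ hφB hG hGC

lemma tendsto_dS1_separatedField {x : R3} (hGx : ContinuousAt G x) :
    Tendsto (fun ε => dS1 M Ω (separatedField φ G) ε x) (𝓝[>] 0) (𝓝 0) := by
  have hbdd := enorm_separatedField_le hφB hGC
  simp only [dS1_eq_integral_bond]
  refine tendsto_integral_bond
    (fun ε => (measurable_stretchS1 M Ω ε (measurable_separatedField hφ hG)).of_uncurry_left)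
    (C := M.alphaBound * (2 * ENNReal.ofReal (B * C))) (by finiteness)
    (fun ε z => enorm_smul_sub_le (nnnorm_chi_mul_alpha_le M Ω _ _ _) (hbdd _ _) (hbdd _ _))
    fun z => ?_
  have hG0 : Tendsto (fun ε : ℝ => M.alphaBound * (B * ‖G (x + ε • z) - G x‖)) (𝓝[>] 0) (𝓝 0) := by
    have h := (hGx.tendsto.comp (tendsto_add_smul x z)).sub_const (G x)
    simpa using (h.norm.const_mul B).const_mul (M.alphaBound : ℝ)
  refine squeeze_zero_norm (fun ε => ?_) hG0
  rw [stretchS1, separatedField, separatedField, ← smul_sub, norm_smul, norm_smul]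
  gcongr
  · exact nnnorm_chi_mul_alpha_le M Ω _ _ _
  · exact hφB _

lemma tendsto_dL_separatedField (x : R3) :
    Tendsto (fun ε => dL M Ω (separatedField φ G) ε x) (𝓝[>] 0) (𝓝 0) := by
  set m : ℝ := ∫ y in Y, φ y
  have hmean : ∫ y in Y, (φ y - m) = 0 := by
    rw [integral_sub (Integrable.of_bound hφ.aestronglyMeasurable B (Eventually.of_forall hφB))
      (integrable_const _), integral_const, probReal_univ, one_smul, sub_self]
  have hbdd (y : R3) : |φ y - m| ≤ B + |m| := (abs_sub _ _).trans (add_le_add_left (hφB y) _)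
  set v : R3 → R3 := fun ξ => (Ω.chi (x + ξ) * M.lam) • G (x + ξ)
  have hv : Measurable v :=
    ((Ω.measurable_chi.comp (measurable_const_add x)).mul_const _).smul
      (hG.comp (measurable_const_add x))
  have hvC (ξ : R3) : ‖v ξ‖ₑ ≤ ‖M.lam‖₊ * ENNReal.ofReal C := by
    rw [enorm_smul, ← ofReal_norm (G _)]
    exact mul_le_mul' (ENNReal.coe_le_coe.2 (nnnorm_chi_mul_lam_le M Ω _))
      (ENNReal.ofReal_le_ofReal (hGC _))
  have hint : Integrable ((Metric.ball 0 M.gam).indicator fun ξ => bond ξ (v ξ)) :=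
    (integrable_indicator_iff measurableSet_ball).2 (integrableOn_bond hv (by finiteness) hvC)
  refine (tendsto_integral_oscillation (hint.comp_sub_right x) (hφ.sub_const m) hbdd
    hmean).congr fun ε => ?_
  rw [dL_eq_integral_bond, ← integral_add_left_eq_self _ x, ← integral_indicator measurableSet_ball]
  congr 1 with ξ : 1
  rw [add_sub_cancel_left]
  by_cases hξ : ξ ∈ Metric.ball 0 M.gam
  · rw [indicator_of_mem hξ, indicator_of_mem hξ, stretchL, setIntegral_separatedField,
      separatedField, ← sub_smul, ← bond_smul, smul_comm]
  · rw [indicator_of_notMem hξ, indicator_of_notMem hξ, smul_zero]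

lemma tendsto_forcing_separatedField {x : R3} (hx : x ∈ Ω.carrier) (hGx : ContinuousAt G x) :
    Tendsto (fun ε => forcing M Ω (separatedField φ G) ε x) (𝓝[>] 0) (𝓝 0) := by
  have hsum : Tendsto (fun ε => dS1 M Ω (separatedField φ G) ε x
      + dS2 M Ω (separatedField φ G) ε x + dL M Ω (separatedField φ G) ε x) (𝓝[>] 0) (𝓝 0) := by
    simpa only [add_zero] using ((tendsto_dS1_separatedField M hφ hφB hG hGC hGx).add
      (tendsto_dS2 M (measurable_separatedField hφ hG) ENNReal.ofReal_ne_top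
        (enorm_separatedField_le hφB hGC) hx)).add (tendsto_dL_separatedField M hφ hφB hG hGC x)
  refine squeeze_zero_norm (fun ε => ?_)
    (by simpa using hsum.norm.const_mul (M.rhoInvBound : ℝ))
  rw [forcing, norm_smul]
  gcongr
  exact M.nnnorm_rho_inv_le _

lemma tendsto_eLpNorm_forcing_separatedField (hGc : ∀ x ∈ Ω.carrier, ContinuousAt G x) {p : ℝ≥0∞}
    (hp : p ≠ ∞) :
    Tendsto (fun ε => eLpNorm (forcing M Ω (separatedField φ G) ε) p
      (volume.restrict Ω.carrier)) (𝓝[>] 0) (𝓝 0) := by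
  have : IsFiniteMeasure (volume.restrict Ω.carrier) :=
    isFiniteMeasure_restrict.2 Ω.isBounded.measure_lt_top.ne
  have hw := measurable_separatedField hφ hG
  refine tendsto_eLpNorm_of_bounded hp (fun ε => (measurable_forcing M Ω ε hw).aestronglyMeasurable)
    (ENNReal.mul_ne_top M.forcingBound_ne_top ENNReal.ofReal_ne_top)
    (enorm_forcing_le M Ω hw (enorm_separatedField_le hφB hGC)) ?_
  filter_upwards [ae_restrict_mem Ω.isOpen.measurableSet] with x hx
  exact tendsto_forcing_separatedField M hφ hφB hG hGC hx (hGc x hx)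

end Limit

section Convergence

variable (M : Medium) {Ω : Body} {p : ℝ≥0∞} [Fact (1 ≤ p)] (hp : p ≠ ∞)

lemma field_indicator_const (s : Set R3) (c : C(closure Ω.carrier, R3)) :
    field (s.indicator fun _ => c) = separatedField (s.indicator 1) (zeroExtend c) := by
  ext1 x
  ext1 y
  by_cases h : toCell y ∈ s
  · simp [field, separatedField, h]
  · simp [field, separatedField, h, zeroExtend]

variable {s : Set R3} (hs : MeasurableSet s) (hμs : volume.restrict Y s ≠ ∞)
  (c : C(closure Ω.carrier, R3))

lemma norm_forcingCLM_indicatorConstLp (ε : Ioc (0 : ℝ) 1) :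
    ‖forcingCLM M hp ε (indicatorConstLp p hs hμs c)‖
      = (eLpNorm (forcing M Ω (separatedField (s.indicator 1) (zeroExtend c)) ε) p
        (volume.restrict Ω.carrier)).toReal := by
  rw [Lp.norm_def, ← field_indicator_const]
  congr 1
  refine eLpNorm_congr_ae ((coeFn_forcingCLM M hp ε _).trans ?_)
  exact forcing_field_congr_ae M (stronglyMeasurable_const.indicator hs)
    (Lp.stronglyMeasurable _) Fact.out hp ε.2.1 ε.2.2
    (memLp_indicator_const p hs c (Or.inr hμs)) indicatorConstLp_coeFn

lemma tendsto_forcingCLM_indicatorConstLp :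
    Tendsto (fun ε => forcingCLM M hp ε (indicatorConstLp p hs hμs c))
      (comap (↑) (𝓝[>] (0 : ℝ))) (𝓝 0) := by
  have hbound (y : R3) : |s.indicator (1 : R3 → ℝ) y| ≤ 1 := by
    by_cases h : y ∈ s <;> simp [h]
  have hLp := tendsto_eLpNorm_forcing_separatedField (Ω := Ω) M (measurable_one.indicator hs) hbound
    (measurable_zeroExtend c) (norm_zeroExtend_le c) (fun _ => continuousAt_zeroExtend c) hp
  rw [tendsto_zero_iff_norm_tendsto_zero]
  simp only [norm_forcingCLM_indicatorConstLp]
  exact ((ENNReal.tendsto_toReal ENNReal.zero_ne_top).comp hLp).comp tendsto_comap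

lemma tendsto_forcingCLM (w : LpPer Ω p) :
    Tendsto (fun ε => forcingCLM M hp ε w) (comap (↑) (𝓝[>] (0 : ℝ))) (𝓝 0) := by
  have hbound : ∃ C, ∀ ε, ‖forcingCLM (Ω := Ω) M hp ε‖ ≤ C := ⟨_, norm_forcingCLM_le M hp⟩
  have hequi : Equicontinuous fun ε => ⇑(forcingCLM (Ω := Ω) M hp ε) :=
    ((NormedSpace.equicontinuous_TFAE (forcingCLM (Ω := Ω) M hp)).out 5 1).1 hbound
  induction w using Lp.induction hp with
  | indicatorConst c hs hμs =>
    rw [Lp.simpleFunc.coe_indicatorConst]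
    exact tendsto_forcingCLM_indicatorConstLp M hp hs hμs.ne c
  | add hf hg _ hlim hlim' =>
    simp only [map_add]
    simpa only [add_zero] using hlim.add hlim'
  | isClosed => exact hequi.isClosed_setOfPred_tendsto continuous_const

/-- The scale `ε = 1 / n` for `n ≥ 1`; the scale with index `0` is `1`. -/
noncomputable def scale (n : ℕ) : Ioc (0 : ℝ) 1 :=
  ⟨1 / max (n : ℝ) 1, by positivity, div_le_one_of_le₀ (le_max_right _ _) (by positivity)⟩

lemma coe_scale {n : ℕ} (hn : 1 ≤ n) : (scale n : ℝ) = 1 / n :=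
  congrArg (1 / ·) (max_eq_left (by exact_mod_cast hn))

lemma tendsto_scale : Tendsto scale atTop (comap (↑) (𝓝[>] (0 : ℝ))) := by
  rw [tendsto_comap_iff]
  refine tendsto_nhdsWithin_iff.2 ⟨?_, Eventually.of_forall fun n => (scale n).2.1⟩
  refine tendsto_one_div_atTop_nhds_zero_nat.congr' ?_
  filter_upwards [eventually_ge_atTop 1] with n hn using (coe_scale hn).symm

end Convergence

end Peridynamics

theorem theorem3p13_general (M : Medium) (Ω : Body) {p : ℝ≥0∞} [Fact (1 ≤ p)] (hp : p ≠ ∞)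
    {S : Type*} [TopologicalSpace S] {K : Set S} (hK : IsCompact K)
    {u : S → LpPer Ω p} (hu : ContinuousOn u K) :
    (∀ n : ℕ, 1 ≤ n → ∀ t ∈ K, ∀ᵐ x ∂((volume : Measure R3).restrict Ω.carrier),
      ForcingConverges M Ω (LpPer.eval (u t)) (1 / n) x) ∧
    ∃ d : ℕ → S → Lp R3 p ((volume : Measure R3).restrict Ω.carrier),
      (∀ n : ℕ, 1 ≤ n → ∀ t ∈ K, ∀ᵐ x ∂((volume : Measure R3).restrict Ω.carrier),
        d n t x = forcing M Ω (LpPer.eval (u t)) (1 / n) x) ∧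
      (∀ n : ℕ, 1 ≤ n → ContinuousOn (d n) K) ∧
      (∃ C : ℝ, ∀ n : ℕ, 1 ≤ n → ∀ t ∈ K, ‖d n t‖ ≤ C) ∧
      (∀ t ∈ K, Tendsto (fun n => ‖d n t‖) atTop (𝓝 0)) := by
  obtain ⟨B, hB⟩ := hK.exists_bound_of_continuousOn hu
  refine ⟨fun n hn t _ => ?_, fun n t => forcingCLM M hp (scale n) (u t), fun n hn t _ => ?_,
    fun n _ => (forcingCLM M hp (scale n)).continuous.comp_continuousOn hu,
    ⟨(M.forcingBound * Ω.oscBound p).toReal * B, fun n _ t ht => ?_⟩, fun t _ => ?_⟩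
  · rw [← coe_scale hn]
    exact ae_forcingConverges_field M (Lp.stronglyMeasurable (u t)) Fact.out hp (scale n).2.1
      (scale n).2.2 (Lp.memLp (u t))
  · rw [← coe_scale hn]
    exact coeFn_forcingCLM M hp (scale n) (u t)
  · exact (forcingCLM M hp (scale n)).le_of_opNorm_le_of_le (norm_forcingCLM_le M hp _) (hB t ht)
  · exact tendsto_zero_iff_norm_tendsto_zero.1 ((tendsto_forcingCLM M hp (u t)).comp tendsto_scale)

theorem theorem3p13 (M : Medium) (Ω : Body) (T : ℝ) (hT : 0 < T)
    (p : ℝ≥0∞) [Fact (1 ≤ p)] (hp : 3 / 2 < p) (hp_top : p < ∞)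
    (u₀ v₀ : LpPer Ω p) (b : ℝ → LpPer Ω p) (hb : ContinuousOn b (Icc 0 T))
    (u : ℝ → LpPer Ω p) (hu : IsTwoScaleSolution M Ω T u₀ v₀ b u) :
    (∀ n : ℕ, 1 ≤ n → ∀ t ∈ Icc 0 T, ∀ᵐ x ∂((volume : Measure R3).restrict Ω.carrier),
      ForcingConverges M Ω (LpPer.eval (u t)) (1 / n) x) ∧
    ∃ d : ℕ → ℝ → Lp R3 p ((volume : Measure R3).restrict Ω.carrier),
      (∀ n : ℕ, 1 ≤ n → ∀ t ∈ Icc 0 T, ∀ᵐ x ∂((volume : Measure R3).restrict Ω.carrier),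
        d n t x = forcing M Ω (LpPer.eval (u t)) (1 / n) x) ∧
      (∀ n : ℕ, 1 ≤ n → ContinuousOn (d n) (Icc 0 T)) ∧
      (∃ C : ℝ, ∀ n : ℕ, 1 ≤ n → ∀ t ∈ Icc 0 T, ‖d n t‖ ≤ C) ∧
      (∀ t ∈ Icc 0 T, Tendsto (fun n => ‖d n t‖) atTop (𝓝 0)) :=
  theorem3p13_general M Ω hp_top.ne isCompact_Icc hu.contDiffOn.continuousOn
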